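/- **Uniform Lipschitz character of flows.** Let $M$ be a $C^\infty$-manifold (finite-dimensional, without boundary, Hausdorff, second countable, connected), let $\mathbb G$ be a $C^\infty$ Riemannian metric on $M$ with Levi-Civita connection $\nabla$ and Riemannian distance $d_{\mathbb G}$, let $\mathbb T\subseteq\mathbb R$ be an interval and let $\mathcal P$ be a topological space. For a locally Lipschitz vector field $\xi$ on $M$ and $x\in M$ put $$\operatorname{dil}\xi(x)=\inf_{\mathcal U}\ \sup\{\|\nabla_{v}\xi\|_{\mathbb G} : y\in \operatorname{cl}(\mathcal U),\ v\in T_yM,\ \|v\|_{\mathbb G}=1,\ \xi \text{ differentiable at } y\},$$ the infimum being over the relatively compact neighbourhoods $\mathcal U$ of $x$, and for $K\subseteq M$ compact put $p_K(\xi)=\max\{\sup_{x\in K}\operatorname{dil}\xi(x),\ \sup_{x\in K}\|\xi(x)\|_{\mathbb G}\}$. Let $X\in\Gamma^{\mathrm{lip}}_{\mathrm{PLI}}(\mathbb T;TM;\mathcal P)$, i.e. let $X(t,x,p)\in T_xM$ for $(t,x,p)\in\mathbb T\times M\times\mathcal P$, write $X^p_t=X(t,\cdot,p)$, and suppose that 1.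 for every $p\in\mathcal P$: every $X^p_t$, $t\in\mathbb T$, is a locally Lipschitz vector field; $t\mapsto X(t,x,p)$ is measurable for every $x\in M$; and $t\mapsto p_K(X^p_t)$ is Lebesgue integrable on $\mathbb S$ for all compact $K\subseteq M$ and $\mathbb S\subseteq\mathbb T$; 2. $p\mapsto X(t,x,p)$ is continuous for every $(t,x)\in\mathbb T\times M$; 3. for every $q\in\mathcal P$, all compact $K\subseteq M$ and $\mathbb S\subseteq\mathbb T$ and every $\epsilon>0$ there is a neighbourhood of $q$ such that $\int_{\mathbb S}p_K(X^p_t-X^{q}_t)\,dt<\epsilon$ for all $p$ in it. An integral curve of $X^p$ is a curve $\xi:J\to M$ on an interval $J\subseteq\mathbb T$ which is locally absolutely continuous (that is, $f\circ\xi$ is locally absolutely continuous for every $f\in C^\infty(M)$) and satisfies $\xi'(t)=X(t,\xi(t),p)$ for almost every $t\in J$. Let $D_X\subseteq\mathbb T\times\mathbb T\times M\times\mathcal P$ be the set of all $(t_1,t_0,x,p)$ for which there is an integral curve of $X^p$ defined on an interval containing $t_0$ and $t_1$ and taking the value $x$ at $t_0$, and let $\Phi^X(t_1,t_0,x,p)$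 be its value at $t_1$. Let $|t_0,t_1|$ denote the closed interval with endpoints $t_0$ and $t_1$. Let $K\subseteq M$ be compact, let $t_0,t_1\in\mathbb T$ and let $p_0\in\mathcal P$ be such that $$|t_0,t_1|\times\{t_0\}\times K\times\{p_0\}\subseteq D_X .$$ Then there exist a neighbourhood $\mathcal O\subseteq\mathcal P$ of $p_0$ and a constant $C>0$ such that $|t_0,t_1|\times\{t_0\}\times K\times\mathcal O\subseteq D_X$ and $$d_{\mathbb G}\big(\Phi^X(t,t_0,x_1,p),\Phi^X(t,t_0,x_2,p)\big)\le C\,d_{\mathbb G}(x_1,x_2),\qquad t\in|t_0,t_1|,\ x_1,x_2\in K,\ p\in\mathcal O .$$ -/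

import Mathlib

open Set Filter MeasureTheory Bundle
open scoped Manifold ContDiff Topology ENNReal NNReal

noncomputable section

namespace LipFlow

/-! ### Lipschitz vector fields and the seminorms of the `C^lip`-topology -/

section Seminorms

variable {E : Type*} [NormedAddCommGroup E] [NormedSpace ℝ E]
  {M : Type*} [TopologicalSpace M] [ChartedSpace E M] [IsManifold 𝓘(ℝ, E) ∞ M]

/-- `ξ` is a locally Lipschitz vector field (an element of `Γ^lip(TM)`): around every point `x₀`,
its local representative in the coordinates of the chart at `x₀` is Lipschitz. -/
def IsLipSection (ξ : (x : M) → TangentSpace 𝓘(ℝ, E) x) : Prop :=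
  ∀ x₀ : M, ∃ C : ℝ≥0, ∃ U ∈ 𝓝 x₀, ∀ y ∈ U, ∀ z ∈ U,
    ‖(trivializationAt E (TangentSpace 𝓘(ℝ, E)) x₀ ⟨y, ξ y⟩).2
        - (trivializationAt E (TangentSpace 𝓘(ℝ, E)) x₀ ⟨z, ξ z⟩).2‖
      ≤ C * ‖extChartAt 𝓘(ℝ, E) x₀ y - extChartAt 𝓘(ℝ, E) x₀ z‖

variable [RiemannianBundle (fun x : M => TangentSpace 𝓘(ℝ, E) x)]

/-- `nabla` is the Levi-Civita connection of the Riemannian metric: a smooth affine connection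
which is torsion-free and compatible with the metric, that is,
`v⟨σ, τ⟩ = ⟨∇_v σ, τ⟩ + ⟨σ, ∇_v τ⟩` for tangent vectors `v` at `x` and vector fields `σ`, `τ` that
are differentiable at `x`. In Mathlib's notation `nabla σ x v` is `∇_v σ`. -/
structure IsLeviCivita [FiniteDimensional ℝ E]
    (nabla : CovariantDerivative 𝓘(ℝ, E) E (fun x : M => TangentSpace 𝓘(ℝ, E) x)) : Prop where
  smooth : nabla.ContMDiffCovariantDerivative ∞
  torsion_free : nabla.torsion = 0
  metric : ∀ (x : M) (v : TangentSpace 𝓘(ℝ, E) x) (σ τ : (y : M) → TangentSpace 𝓘(ℝ, E) y),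
    MDifferentiableAt 𝓘(ℝ, E) (𝓘(ℝ, E).prod 𝓘(ℝ, E))
      (fun z => (⟨z, σ z⟩ : TangentBundle 𝓘(ℝ, E) M)) x →
    MDifferentiableAt 𝓘(ℝ, E) (𝓘(ℝ, E).prod 𝓘(ℝ, E))
      (fun z => (⟨z, τ z⟩ : TangentBundle 𝓘(ℝ, E) M)) x →
    (mfderiv 𝓘(ℝ, E) 𝓘(ℝ, ℝ) (fun y => inner ℝ (σ y) (τ y)) x v : ℝ)
      = inner ℝ (nabla σ x v) (τ x) + inner ℝ (σ x) (nabla τ x v)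

variable (nabla : CovariantDerivative 𝓘(ℝ, E) E (fun x : M => TangentSpace 𝓘(ℝ, E) x))

/-- The local sectional dilatation `dil ξ (x)`: the infimum, over the relatively compact
neighbourhoods `U` of `x`, of the supremum of `‖∇_v ξ‖` over the unit tangent vectors `v` at the
points `y ∈ cl(U)` at which `ξ` is differentiable. -/
def dil (ξ : (x : M) → TangentSpace 𝓘(ℝ, E) x) (x : M) : ℝ≥0∞ :=
  ⨅ (U : Set M) (_ : U ∈ 𝓝 x) (_ : IsCompact (closure U)),
    ⨆ (y : M) (_ : y ∈ closure U)
      (_ : MDifferentiableAt 𝓘(ℝ, E) (𝓘(ℝ, E).prod 𝓘(ℝ, E))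
        (fun z => (⟨z, ξ z⟩ : TangentBundle 𝓘(ℝ, E) M)) y)
      (v : TangentSpace 𝓘(ℝ, E) y) (_ : ‖v‖ = 1), ‖nabla ξ y v‖ₑ

/-- The seminorm `p_K^lip(ξ) = max (sup_K dil ξ) (sup_K ‖ξ‖)` of the `C^lip`-topology. -/
def pLip (K : Set M) (ξ : (x : M) → TangentSpace 𝓘(ℝ, E) x) : ℝ≥0∞ :=
  max (⨆ x ∈ K, dil nabla ξ x) (⨆ x ∈ K, ‖ξ x‖ₑ)

/-- `X` is a locally integrally `C^lip`-bounded time-dependent vector field on the time interval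
`T`, i.e. `X ∈ Γ^lip_LI(T; TM)`: each `X_t` is locally Lipschitz, `t ↦ X_t` is measurable, and
`t ↦ p_K^lip(X_t)` is integrable on every compact `S ⊆ T`, for every compact `K ⊆ M`.
Values at times outside `T` are irrelevant. -/
structure IsLipLI (T : Set ℝ) (X : ℝ → (x : M) → TangentSpace 𝓘(ℝ, E) x) : Prop where
  lip : ∀ t ∈ T, IsLipSection (X t)
  measurable : ∀ x : M, AEStronglyMeasurable (fun t => X t x) (volume.restrict T)
  integrable : ∀ K : Set M, IsCompact K → ∀ S ⊆ T, IsCompact S →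
    AEMeasurable (fun t => pLip nabla K (X t)) (volume.restrict S) ∧
      ∫⁻ t in S, pLip nabla K (X t) < ⊤

/-- `X` is a parameter-dependent, locally integrally bounded vector field of class `C^lip`,
i.e. `X ∈ Γ^lip_PLI(T; TM; P)`; `X p t x` is the value at the parameter `p`, time `t`, state `x`.
The last field is the continuity of `p ↦ X^p` for the seminorms
`ξ ↦ ∫_S p_K^lip(ξ_t) dt`. -/
structure IsLipPLI {P : Type*} [TopologicalSpace P] (T : Set ℝ)
    (X : P → ℝ → (x : M) → TangentSpace 𝓘(ℝ, E) x) : Prop where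
  isLipLI : ∀ p, IsLipLI nabla T (X p)
  continuous_param : ∀ t ∈ T, ∀ x : M, Continuous fun p => X p t x
  continuous : ∀ p₀ : P, ∀ K : Set M, IsCompact K → ∀ S ⊆ T, IsCompact S →
    ∀ ε : ℝ≥0∞, 0 < ε → ∀ᶠ p in 𝓝 p₀,
      AEMeasurable (fun t => pLip nabla K (X p t - X p₀ t)) (volume.restrict S) ∧
        ∫⁻ t in S, pLip nabla K (X p t - X p₀ t) < ε

end Seminorms

/-! ### Integral curves and flows -/

section Flow

variable {E : Type*} [NormedAddCommGroup E] [NormedSpace ℝ E]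
  {M : Type*} [TopologicalSpace M] [ChartedSpace E M]

/-- `γ` restricted to the interval `J` is locally absolutely continuous: its composition with
every smooth function on `M` is absolutely continuous on every compact subinterval of `J`. -/
def LocACOn (γ : ℝ → M) (J : Set ℝ) : Prop :=
  ∀ f : M → ℝ, ContMDiff 𝓘(ℝ, E) 𝓘(ℝ, ℝ) ∞ f →
    ∀ a ∈ J, ∀ b ∈ J, AbsolutelyContinuousOnInterval (f ∘ γ) a b

/-- `γ : J → M` is an integral curve of the time-dependent vector field `X` on `T`, where `J` is a
subinterval of `T`. Values of `γ` outside `J` are irrelevant. -/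
structure IsIntCurve (T : Set ℝ) (X : ℝ → (x : M) → TangentSpace 𝓘(ℝ, E) x)
    (γ : ℝ → M) (J : Set ℝ) : Prop where
  ordConnected : J.OrdConnected
  subset : J ⊆ T
  locAC : LocACOn (E := E) γ J
  deriv : ∀ᵐ t : ℝ, t ∈ J → HasMFDerivWithinAt 𝓘(ℝ, ℝ) 𝓘(ℝ, E) γ J t
    ((1 : ℝ →L[ℝ] ℝ).smulRight (X t (γ t)))

/-- There is an integral curve of `X` which is at `x₀` at time `t₀`, is still defined at
time `t₁`, and is at `y` at time `t₁`. -/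
def Reaches (T : Set ℝ) (X : ℝ → (x : M) → TangentSpace 𝓘(ℝ, E) x) (t₁ t₀ : ℝ) (x₀ y : M) :
    Prop :=
  ∃ (J : Set ℝ) (γ : ℝ → M), IsIntCurve T X γ J ∧ t₀ ∈ J ∧ γ t₀ = x₀ ∧ t₁ ∈ J ∧ γ t₁ = y

/-- The interval of existence `J_X(t₀, x₀, p₀)`: the union of the intervals `J ⊆ T` on which there
is an integral curve of `X^{p₀}` with value `x₀` at time `t₀`. -/
def existenceInterval {P : Type*} (T : Set ℝ) (X : P → ℝ → (x : M) → TangentSpace 𝓘(ℝ, E) x)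
    (t₀ : ℝ) (x₀ : M) (p₀ : P) : Set ℝ :=
  {t₁ | ∃ y, Reaches T (X p₀) t₁ t₀ x₀ y}

/-- The domain `D_X ⊆ T × T × M × P` of the flow of `X`. -/
def flowDomain {P : Type*} (T : Set ℝ) (X : P → ℝ → (x : M) → TangentSpace 𝓘(ℝ, E) x) :
    Set (ℝ × ℝ × M × P) :=
  {q | q.1 ∈ T ∧ q.2.1 ∈ T ∧ q.1 ∈ existenceInterval T X q.2.1 q.2.2.1 q.2.2.2}

open Classical in
/-- The flow `Φ^X(t₁, t₀, x₀, p₀) = ξ(t₁)`, where `ξ` is the integral curve of `X^{p₀}` with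
`ξ(t₀) = x₀`; only its values on `flowDomain T X` are meaningful. -/
def flow {P : Type*} (T : Set ℝ) (X : P → ℝ → (x : M) → TangentSpace 𝓘(ℝ, E) x)
    (t₁ t₀ : ℝ) (x₀ : M) (p₀ : P) : M :=
  if h : ∃ y, Reaches T (X p₀) t₁ t₀ x₀ y then h.choose else x₀

end Flow

end LipFlow

end

/-! In a chart, `∇_v ξ` differs from the ordinary derivative of the representative of `ξ` by a term
of order zero (Christoffel symbols). A bound on `p_K` therefore bounds both the size of the
representative and its derivative wherever that exists. Rademacher's theorem and the convexity of
balls turn this into a Lipschitz constant on a chart ball (`exists_chartRep_lipschitz`).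

Hence `X^{p₀}` in a chart is a Carathéodory right-hand side with an integrable Lipschitz bound, and
so is `X^p`, whose bound is the one for `X^{p₀}` plus the one for the difference; the latter has
small integral for `p` near `p₀`. On time intervals where the total bound has integral at most
`1/2`, Picard iteration gives solutions, and a direct absorption argument in place of Gronwall's
inequality gives uniqueness, Lipschitz dependence on the initial value with constant `2`, and
closeness to the solution for `p₀` (`norm_sub_le_of_integral_eq`). The Riemannian distance is
locally comparable with the chart distance, so this becomes a local estimate on `M`
(`IsLipPLI.exists_hasLipschitzFlow`).

Such estimates compose (`HasLipschitzFlow.trans`). Compactness of the time interval propagates them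
along a whole integral curve (`IsIntCurve.hasLipschitzFlow`), with neighbourhoods of the initial
point and of `p₀` that serve all intermediate times.

Finally `K` is covered by finitely many of these neighbourhoods. Initial points that are close lie
in a common neighbourhood, where the local estimate applies. For points that are at least some `ρ`
apart, the images lie in a compact set of finite Riemannian diameter `D`, and `D ≤ (D / ρ) d(x₁,
x₂)`. -/

set_option linter.unusedSectionVars false

noncomputable section

namespace LipFlow

/-! ### Absolute continuity and the fundamental theorem of calculus -/

section Calculus

variable {E : Type*} [NormedAddCommGroup E] [NormedSpace ℝ E]

/-- A curve dominated by an absolutely continuous real function is absolutely continuous. -/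
theorem absolutelyContinuousOnInterval_of_dist_le {Y : Type*} [PseudoMetricSpace Y]
    {g : ℝ → ℝ} {h : ℝ → Y} {a b C : ℝ} (hg : AbsolutelyContinuousOnInterval g a b)
    (hle : ∀ s ∈ uIcc a b, ∀ t ∈ uIcc a b, dist (h s) (h t) ≤ C * dist (g s) (g t)) :
    AbsolutelyContinuousOnInterval h a b := by
  rw [absolutelyContinuousOnInterval_iff] at hg ⊢
  intro ε hε
  -- `|C| + 1` is positive whatever the sign of `C`.
  obtain ⟨δ, hδ, H⟩ := hg (ε / (|C| + 1)) (by positivity)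
  refine ⟨δ, hδ, fun A hA hlt => ?_⟩
  have h1 := H A hA hlt
  calc ∑ i ∈ Finset.range A.1, dist (h (A.2 i).1) (h (A.2 i).2)
      ≤ ∑ i ∈ Finset.range A.1, (|C| + 1) * dist (g (A.2 i).1) (g (A.2 i).2) := by
        refine Finset.sum_le_sum fun i hi => ?_
        have := hA.1 i hi
        refine (hle _ this.1 _ this.2).trans ?_
        gcongr
        linarith [le_abs_self C]
    _ = (|C| + 1) * ∑ i ∈ Finset.range A.1, dist (g (A.2 i).1) (g (A.2 i).2) := by
        rw [Finset.mul_sum]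
    _ < (|C| + 1) * (ε / (|C| + 1)) := by gcongr
    _ = ε := by field_simp

/-- The fundamental theorem of calculus for curves which are weakly absolutely continuous. -/
theorem integral_eq_sub_of_forall_dual [CompleteSpace E] {h g : ℝ → E} {a b : ℝ}
    (hac : ∀ l : E →L[ℝ] ℝ, AbsolutelyContinuousOnInterval (fun t => l (h t)) a b)
    (hder : ∀ᵐ t : ℝ, t ∈ uIoc a b → HasDerivAt h (g t) t)
    (hg : IntervalIntegrable g volume a b) : ∫ t in a..b, g t = h b - h a := by
  refine (SeparatingDual.eq_iff_forall_dual_eq (R := ℝ)).2 fun l => ?_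
  have h1 := (hac l).integral_deriv_eq_sub
  have h2 : ∫ t in a..b, deriv (fun t => l (h t)) t = ∫ t in a..b, l (g t) := by
    refine intervalIntegral.integral_congr_ae ?_
    filter_upwards [hder] with t ht htm
    exact (l.hasFDerivAt.comp_hasDerivAt t (ht htm)).deriv
  have h3 : ∫ t in a..b, l (g t) = l (∫ t in a..b, g t) :=
    l.intervalIntegral_comp_comm hg
  rw [← h3, ← h2, h1, map_sub]

/-- A Lipschitz function whose derivative is bounded by `L` almost everywhere on an open convex
set is `L`-Lipschitz on this set. -/
theorem lipschitzOnWith_of_ae_norm_fderiv_le [FiniteDimensional ℝ E] [MeasurableSpace E]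
    [BorelSpace E] (μ : Measure E) [μ.IsAddHaarMeasure] {F : Type*} [NormedAddCommGroup F]
    [NormedSpace ℝ F] [FiniteDimensional ℝ F] {f : E → F} {K : ℝ≥0} (hf : LipschitzWith K f)
    {U : Set E} (hU : IsOpen U) (hUc : Convex ℝ U) {L : ℝ}
    (hL : ∀ᵐ x ∂μ, x ∈ U → ∀ v, ‖fderiv ℝ f x v‖ ≤ L * ‖v‖) :
    ∀ x ∈ U, ∀ y ∈ U, ‖f x - f y‖ ≤ L * ‖x - y‖ := by
  have hgood : ∀ᵐ x ∂μ, DifferentiableAt ℝ f x ∧ (x ∈ U → ∀ v, ‖fderiv ℝ f x v‖ ≤ L * ‖v‖) := by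
    filter_upwards [hf.ae_differentiableAt, hL] with x h1 h2 using ⟨h1, h2⟩
  -- The Fubini argument below needs a measurable set of good points, still of full measure.
  obtain ⟨S, hSsub, hSm, hSae⟩ : ∃ S : Set E, (∀ x ∈ S, DifferentiableAt ℝ f x ∧
      (x ∈ U → ∀ v, ‖fderiv ℝ f x v‖ ≤ L * ‖v‖)) ∧ MeasurableSet S ∧ ∀ᵐ x ∂μ, x ∈ S := by
    obtain ⟨t, h1, h2, h3⟩ := MeasureTheory.exists_measurable_superset_of_null hgood
    refine ⟨tᶜ, fun x hx => ?_, h2.compl, ?_⟩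
    · by_contra hc
      exact hx (h1 hc)
    · rw [ae_iff]; simpa using h3
  -- By Fubini, almost every line in the direction `v` meets the complement of `S` in a null set. On
  -- such a line the derivative bound holds almost everywhere and can be integrated.
  have step : ∀ v : E, ∀ᵐ z ∂μ, z ∈ U → z + v ∈ U → ‖f (z + v) - f z‖ ≤ L * ‖v‖ := by
    intro v
    let A : ℝ →ₗ[ℝ] E := LinearMap.toSpanSingleton ℝ E v
    have hA := (ae_ae_add_linearMap_mem_iff A volume μ hSm).2 hSae
    filter_upwards [hA] with z hz hzU hzvU
    let h : ℝ → F := fun t => f (z + t • v)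
    have hlip : LipschitzWith (K * ‖v‖₊) h := by
      refine hf.comp (LipschitzWith.of_dist_le_mul fun s t => ?_)
      rw [dist_add_left, dist_eq_norm, ← sub_smul, norm_smul, dist_eq_norm]
      simp [mul_comm]
    have hseg : ∀ t ∈ Icc (0 : ℝ) 1, z + t • v ∈ U := by
      intro t ht
      have := hUc.add_smul_sub_mem hzU hzvU ht
      simpa using this
    -- A norming functional reduces the increment to that of a real function, to which the
    -- fundamental theorem of calculus applies.
    obtain ⟨l, hl1, hl2⟩ := exists_dual_vector'' ℝ (f (z + v) - f z)
    have hlL : LipschitzWith (‖l‖₊ * (K * ‖v‖₊)) (fun t => l (h t)) := l.lipschitz.comp hlip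
    have hFTC := (hlL.lipschitzOnWith (s := uIcc 0 1)).absolutelyContinuousOnInterval
      |>.integral_deriv_eq_sub
    have hb : ∀ᵐ t : ℝ, t ∈ uIoc (0 : ℝ) 1 → ‖deriv (fun t => l (h t)) t‖ ≤ L * ‖v‖ := by
      filter_upwards [hz] with t ht htm
      rw [uIoc_of_le zero_le_one] at htm
      have htS : z + t • v ∈ S := by simpa [A] using ht
      obtain ⟨hd, hbd⟩ := hSsub _ htS
      have hline : HasDerivAt (fun t : ℝ => z + t • v) v t := by
        simpa using ((hasDerivAt_id t).smul_const v).const_add z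
      have : HasDerivAt h (fderiv ℝ f (z + t • v) v) t := hd.hasFDerivAt.comp_hasDerivAt t hline
      have hder : deriv (fun t => l (h t)) t = l (fderiv ℝ f (z + t • v) v) :=
        (l.hasFDerivAt.comp_hasDerivAt t this).deriv
      rw [hder]
      have h1 := hbd (hseg t ⟨htm.1.le, htm.2⟩) v
      calc ‖l (fderiv ℝ f (z + t • v) v)‖ ≤ ‖l‖ * ‖fderiv ℝ f (z + t • v) v‖ := l.le_opNorm _
        _ ≤ 1 * ‖fderiv ℝ f (z + t • v) v‖ := by gcongr
        _ ≤ L * ‖v‖ := by simpa using h1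
    have := intervalIntegral.norm_integral_le_of_norm_le_const_ae hb
    rw [hFTC] at this
    have e : l (h 1) - l (h 0) = ‖f (z + v) - f z‖ := by
      rw [← map_sub]; simpa [h] using hl2
    rw [e] at this
    simpa using this
  intro x hx y hy
  have hxy := step (x - y)
  -- The point `y` itself may be exceptional, but a set of full measure is dense and the inequality
  -- is a closed condition.
  have hcl : y ∈ closure {z | z ∈ U → z + (x - y) ∈ U → ‖f (z + (x - y)) - f z‖ ≤ L * ‖x - y‖} :=
    (Measure.dense_of_ae hxy) y
  have hopen : {z | z ∈ U ∧ z + (x - y) ∈ U} ∈ 𝓝 y := by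
    refine (hU.inter (hU.preimage (by fun_prop : Continuous fun z : E => z + (x - y)))).mem_nhds ?_
    exact ⟨hy, by simpa using hx⟩
  have hcl2 : y ∈ closure {z | ‖f (z + (x - y)) - f z‖ ≤ L * ‖x - y‖} := by
    rw [mem_closure_iff_frequently] at hcl ⊢
    exact (hcl.and_eventually hopen).mono fun z hz => hz.1 hz.2.1 hz.2.2
  have hclosed : IsClosed {z | ‖f (z + (x - y)) - f z‖ ≤ L * ‖x - y‖} := by
    have := hf.continuous
    exact isClosed_le (by fun_prop) continuous_const
  have := hclosed.closure_eq ▸ hcl2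
  simpa using this

end Calculus

/-! ### Carathéodory differential equations in a finite-dimensional space -/

section Caratheodory

variable {E : Type*} [NormedAddCommGroup E] [NormedSpace ℝ E] [FiniteDimensional ℝ E]

/-- `f` is measurable in time and, for almost every time `t` in `I`, bounded by `m t` and
`m t`-Lipschitz on `B`, with `m` integrable. -/
structure IsCaratheodoryOn (f : ℝ → E → E) (m : ℝ → ℝ) (B : Set E) (I : Set ℝ) : Prop where
  measurable : ∀ x ∈ B, AEStronglyMeasurable (fun t => f t x) (volume.restrict I)
  integrable : IntegrableOn m I
  bound : ∀ᵐ t ∂volume.restrict I, 0 ≤ m t ∧ (∀ x ∈ B, ‖f t x‖ ≤ m t) ∧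
    ∀ x ∈ B, ∀ y ∈ B, ‖f t x - f t y‖ ≤ m t * ‖x - y‖

theorem IsCaratheodoryOn.mono {f : ℝ → E → E} {m : ℝ → ℝ} {B : Set E} {I J : Set ℝ}
    (hf : IsCaratheodoryOn f m B I) (h : J ⊆ I) : IsCaratheodoryOn f m B J where
  measurable x hx := (hf.measurable x hx).mono_measure (Measure.restrict_mono_set _ h)
  integrable := hf.integrable.mono_set h
  bound := ae_restrict_of_ae_restrict_of_subset h hf.bound

/-- Composition of a Carathéodory function with a measurable curve. -/
theorem aestronglyMeasurable_comp_of_continuousOn [MeasurableSpace E] [BorelSpace E]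
    {ν : Measure ℝ} {f : ℝ → E → E} {B : Set E} {u : ℝ → E}
    (hmeas : ∀ x ∈ B, AEStronglyMeasurable (fun t => f t x) ν)
    (hcont : ∀ᵐ t ∂ν, ContinuousOn (f t) B) (hu : Measurable u) (huB : ∀ t, u t ∈ B) :
    AEStronglyMeasurable (fun t => f t (u t)) ν := by
  have h₀ := huB 0
  -- Along a simple function with values in `B` the composition is a finite sum of measurable
  -- functions restricted to fibres. Continuity of `f t` on `B` then passes to the limit.
  let s : ℕ → SimpleFunc ℝ E := SimpleFunc.approxOn u hu B (u 0) h₀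
  have hs : ∀ n t, s n t ∈ B := fun n t => SimpleFunc.approxOn_mem hu h₀ n t
  refine aestronglyMeasurable_of_tendsto_ae atTop (f := fun n t => f t (s n t)) (fun n => ?_) ?_
  · have key : (fun t => f t (s n t))
        = fun t => ∑ y ∈ (s n).range, (s n ⁻¹' {y}).indicator (fun t => f t y) t := by
      funext t
      rw [Finset.sum_eq_single (s n t)]
      · simp
      · intro y _ hy
        exact indicator_of_notMem (fun h => hy (by simpa using h.symm)) _
      · intro h
        exact absurd ((s n).mem_range_self t) h
    rw [key]
    refine Finset.aestronglyMeasurable_fun_sum _ fun y hy => ?_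
    obtain ⟨t, rfl⟩ := SimpleFunc.mem_range.1 hy
    exact (hmeas _ (hs n t)).indicator ((s n).measurableSet_fiber _)
  · filter_upwards [hcont] with t ht
    have h1 : Tendsto (fun n => s n t) atTop (𝓝[B] (u t)) :=
      tendsto_nhdsWithin_iff.2 ⟨SimpleFunc.tendsto_approxOn hu h₀ (subset_closure (huB t)),
        Eventually.of_forall fun n => hs n t⟩
    exact (ht (u t) (huB t)).tendsto.comp h1

/-- Extending `u` by its end values outside the interval gives a continuous curve on the whole line
with values in `B`, so that composing with simple approximations makes sense; `m` then dominates. -/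
theorem IsCaratheodoryOn.integrableOn_comp {f : ℝ → E → E} {m : ℝ → ℝ} {B : Set E} {a b : ℝ}
    (hf : IsCaratheodoryOn f m B (uIcc a b)) {u : ℝ → E} (hu : ContinuousOn u (uIcc a b))
    (huB : ∀ t ∈ uIcc a b, u t ∈ B) :
    IntegrableOn (fun t => f t (u t)) (uIcc a b) := by
  borelize E
  have hle : min a b ≤ max a b := min_le_max
  let v : ℝ → E := fun t => u (projIcc (min a b) (max a b) hle t)
  have hv : Continuous v :=
    (continuousOn_iff_continuous_domRestrict.1 hu).comp continuous_projIcc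
  have hvB : ∀ t, v t ∈ B := fun t => huB _ (projIcc _ _ hle t).2
  have hvu : ∀ t ∈ uIcc a b, v t = u t := fun t ht => by
    simp only [v]; rw [projIcc_of_mem hle ht]
  have hmeas : AEStronglyMeasurable (fun t => f t (v t)) (volume.restrict (uIcc a b)) := by
    refine aestronglyMeasurable_comp_of_continuousOn hf.measurable ?_ hv.measurable hvB
    filter_upwards [hf.bound] with t ht
    refine (LipschitzOnWith.of_dist_le_mul (K := (m t).toNNReal) fun x hx y hy => ?_).continuousOn
    rw [dist_eq_norm, dist_eq_norm, Real.coe_toNNReal _ ht.1]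
    exact ht.2.2 x hx y hy
  have hmeas' : AEStronglyMeasurable (fun t => f t (u t)) (volume.restrict (uIcc a b)) := by
    refine hmeas.congr ?_
    filter_upwards [ae_restrict_mem measurableSet_uIcc] with t ht
    simp only [hvu t ht]
  refine Integrable.mono' hf.integrable hmeas' ?_
  filter_upwards [hf.bound, ae_restrict_mem measurableSet_uIcc] with t ht htm
  exact ht.2.1 _ (huB t htm)

theorem intervalIntegrable_of_integrableOn_uIcc {F : Type*} [NormedAddCommGroup F] {g : ℝ → F}
    {a b s t : ℝ} (hg : IntegrableOn g (uIcc a b)) (hs : s ∈ uIcc a b) (ht : t ∈ uIcc a b) :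
    IntervalIntegrable g volume s t :=
  (hg.mono_set (uIcc_subset_uIcc hs ht)).intervalIntegrable

/-- The norm of an integral over a subinterval is bounded by the integral of a majorant. -/
theorem norm_intervalIntegral_le_setIntegral {F : Type*} [NormedAddCommGroup F] [NormedSpace ℝ F]
    {g : ℝ → F} {k : ℝ → ℝ} {a b s t : ℝ} (hs : s ∈ uIcc a b) (ht : t ∈ uIcc a b)
    (hk : IntegrableOn k (uIcc a b)) (hle : ∀ᵐ r ∂volume.restrict (uIcc a b), ‖g r‖ ≤ k r) :
    ‖∫ r in s..t, g r‖ ≤ ∫ r in uIcc a b, k r := by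
  have hsub : uIoc s t ⊆ uIcc a b := uIoc_subset_uIcc.trans (uIcc_subset_uIcc hs ht)
  rw [intervalIntegral.norm_integral_eq_norm_integral_uIoc]
  calc ‖∫ r in uIoc s t, g r‖ ≤ ∫ r in uIoc s t, k r :=
        norm_integral_le_of_norm_le (hk.mono_set hsub)
          (ae_restrict_of_ae_restrict_of_subset hsub hle)
    _ ≤ ∫ r in uIcc a b, k r := by
        refine setIntegral_mono_set hk ?_ hsub.eventuallyLE
        filter_upwards [hle] with r hr using (norm_nonneg _).trans hr

/-- Stability of solutions with respect to the initial value and the right-hand side. -/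
theorem norm_sub_le_of_integral_eq {f g : ℝ → E → E} {m m' n : ℝ → ℝ} {B : Set E} {a b : ℝ}
    (hf : IsCaratheodoryOn f m B (uIcc a b)) (hg : IsCaratheodoryOn g m' B (uIcc a b))
    (hm : ∫ t in uIcc a b, m t ≤ 1 / 2) (hn : IntegrableOn n (uIcc a b))
    (hfg : ∀ᵐ t ∂volume.restrict (uIcc a b), ∀ x ∈ B, ‖f t x - g t x‖ ≤ n t)
    {u v : ℝ → E} (hu : ContinuousOn u (uIcc a b)) (hv : ContinuousOn v (uIcc a b))
    (huB : ∀ t ∈ uIcc a b, u t ∈ B) (hvB : ∀ t ∈ uIcc a b, v t ∈ B)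
    (hueq : ∀ t ∈ uIcc a b, u t = u a + ∫ s in a..t, f s (u s))
    (hveq : ∀ t ∈ uIcc a b, v t = v a + ∫ s in a..t, g s (v s)) :
    ∀ t ∈ uIcc a b, ‖u t - v t‖ ≤ 2 * (‖u a - v a‖ + ∫ s in uIcc a b, n s) := by
  -- At a maximum `D` of the distance, the integral equations give `D ≤ ‖u a - v a‖ + D / 2 + ∫ n`
  -- because `∫ m ≤ 1 / 2`. Absorbing `D / 2` yields the factor `2` without Gronwall's inequality.
  obtain ⟨τ, hτ, hmax⟩ := isCompact_uIcc.exists_isMaxOn (nonempty_uIcc (a := a) (b := b))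
    ((hu.sub hv).norm)
  set D := ‖u τ - v τ‖ with hD
  have hmax' : ∀ t ∈ uIcc a b, ‖u t - v t‖ ≤ D := fun t ht => hmax ht
  have hiu := hf.integrableOn_comp hu huB
  have hiv := hg.integrableOn_comp hv hvB
  have key : ∀ t ∈ uIcc a b, ‖u t - v t‖ ≤ ‖u a - v a‖ + (D / 2 + ∫ s in uIcc a b, n s) := by
    intro t ht
    have e : u t - v t = (u a - v a) + ∫ s in a..t, (f s (u s) - g s (v s)) := by
      rw [intervalIntegral.integral_sub
        (intervalIntegrable_of_integrableOn_uIcc hiu left_mem_uIcc ht)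
        (intervalIntegrable_of_integrableOn_uIcc hiv left_mem_uIcc ht), hueq t ht, hveq t ht]
      abel
    rw [e]
    refine (norm_add_le _ _).trans ?_
    gcongr
    have hk : IntegrableOn (fun s => m s * D + n s) (uIcc a b) :=
      (hf.integrable.mul_const D).add hn
    refine (norm_intervalIntegral_le_setIntegral left_mem_uIcc ht hk ?_).trans ?_
    · filter_upwards [hf.bound, hfg, ae_restrict_mem measurableSet_uIcc] with s h1 h2 hs
      calc ‖f s (u s) - g s (v s)‖
          = ‖(f s (u s) - f s (v s)) + (f s (v s) - g s (v s))‖ := by congr 1; abel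
        _ ≤ ‖f s (u s) - f s (v s)‖ + ‖f s (v s) - g s (v s)‖ := norm_add_le _ _
        _ ≤ m s * D + n s := by
          refine add_le_add ((h1.2.2 _ (huB s hs) _ (hvB s hs)).trans ?_) (h2 _ (hvB s hs))
          exact mul_le_mul_of_nonneg_left (hmax' s hs) h1.1
    · rw [integral_add (hf.integrable.mul_const D) hn, integral_mul_const]
      have : 0 ≤ D := norm_nonneg _
      nlinarith
  intro t ht
  have h1 := key τ hτ
  have h2 := hmax' t ht
  rw [← hD] at h1
  linarith

/-- Existence of solutions of Carathéodory differential equations. -/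
theorem IsCaratheodoryOn.exists_solution {f : ℝ → E → E} {m : ℝ → ℝ} {c : E} {r : ℝ} {a b : ℝ}
    (hf : IsCaratheodoryOn f m (Metric.closedBall c r) (uIcc a b))
    (hm : ∫ t in uIcc a b, m t ≤ 1 / 2) (hmr : ∫ t in uIcc a b, m t ≤ r / 2)
    {x : E} (hx : x ∈ Metric.closedBall c (r / 2)) :
    ∃ u : ℝ → E, ContinuousOn u (uIcc a b) ∧ (∀ t ∈ uIcc a b, u t ∈ Metric.closedBall c r) ∧
      ∀ t ∈ uIcc a b, u t = x + ∫ s in a..t, f s (u s) := by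
  set I := uIcc a b with hI
  set B := Metric.closedBall c r with hB
  have hle : min a b ≤ max a b := min_le_max
  have : CompactSpace I := isCompact_iff_compactSpace.1 isCompact_uIcc
  let p : ℝ → I := projIcc (min a b) (max a b) hle
  have hpI : ∀ t (ht : t ∈ I), p t = ⟨t, ht⟩ := fun t ht => projIcc_of_mem hle ht
  -- Banach's fixed point theorem is applied to the complete space of continuous curves in the ball.
  -- The projection `p` turns a curve on the compact type `I` into a function on the line.
  let Z : Set C(I, E) := {u | ∀ t, u t ∈ B}
  have hZc : IsClosed Z := by
    have : Z = ⋂ t : I, (fun u : C(I, E) => u t) ⁻¹' B := by ext u; simp [Z]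
    rw [this]
    exact isClosed_iInter fun t => Metric.isClosed_closedBall.preimage (by fun_prop)
  have hcont : ∀ u : C(I, E), ContinuousOn (fun t => u (p t)) I := fun u =>
    (u.continuous.comp continuous_projIcc).continuousOn
  have hint : ∀ u ∈ Z, IntegrableOn (fun t => f t (u (p t))) I := fun u hu =>
    hf.integrableOn_comp (hcont u) fun t _ => hu (p t)
  have hFc : ∀ u ∈ Z, Continuous fun t : I => x + ∫ s in a..(t : ℝ), f s (u (p s)) := by
    intro u hu
    have h1 : ContinuousOn (fun t => ∫ s in a..t, f s (u (p s))) (uIcc a b) :=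
      intervalIntegral.continuousOn_primitive_interval'
        (intervalIntegrable_of_integrableOn_uIcc (hint u hu) left_mem_uIcc right_mem_uIcc)
        left_mem_uIcc
    exact continuous_const.add (continuousOn_iff_continuous_domRestrict.1 h1)
  have hxc : dist x c ≤ r / 2 := Metric.mem_closedBall.1 hx
  -- The start lies within `r / 2` of the centre and the displacement is at most `r / 2`.
  have hFB : ∀ u ∈ Z, ∀ t : I, x + ∫ s in a..(t : ℝ), f s (u (p s)) ∈ B := by
    intro u hu t
    have h1 : ‖∫ s in a..(t : ℝ), f s (u (p s))‖ ≤ ∫ s in uIcc a b, m s := by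
      refine norm_intervalIntegral_le_setIntegral left_mem_uIcc t.2 hf.integrable ?_
      filter_upwards [hf.bound] with s hs using hs.2.1 _ (hu _)
    rw [hB, Metric.mem_closedBall, dist_eq_norm]
    rw [dist_eq_norm] at hxc
    calc ‖x + (∫ s in a..(t : ℝ), f s (u (p s))) - c‖
        = ‖(x - c) + ∫ s in a..(t : ℝ), f s (u (p s))‖ := by congr 1; abel
      _ ≤ ‖x - c‖ + ‖∫ s in a..(t : ℝ), f s (u (p s))‖ := norm_add_le _ _
      _ ≤ r := by linarith
  let F : Z → Z := fun u => ⟨⟨_, hFc u u.2⟩, fun t => hFB u u.2 t⟩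
  have hcontr : ContractingWith (1 / 2) F := by
    refine ⟨by rw [← NNReal.coe_lt_coe]; norm_num, LipschitzWith.of_dist_le_mul fun u v => ?_⟩
    rw [Subtype.dist_eq]
    refine (ContinuousMap.dist_le (by positivity)).2 fun t => ?_
    change dist (x + ∫ s in a..(t : ℝ), f s (u.1 (p s))) (x + ∫ s in a..(t : ℝ), f s (v.1 (p s)))
      ≤ _
    rw [dist_add_left, dist_eq_norm, ← intervalIntegral.integral_sub
      (intervalIntegrable_of_integrableOn_uIcc (hint u u.2) left_mem_uIcc t.2)
      (intervalIntegrable_of_integrableOn_uIcc (hint v v.2) left_mem_uIcc t.2)]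
    refine (norm_intervalIntegral_le_setIntegral left_mem_uIcc t.2
      (hf.integrable.mul_const (dist u v)) ?_).trans ?_
    · filter_upwards [hf.bound] with s hs
      refine (hs.2.2 _ (u.2 _) _ (v.2 _)).trans (mul_le_mul_of_nonneg_left ?_ hs.1)
      rw [← dist_eq_norm, Subtype.dist_eq]
      exact ContinuousMap.dist_apply_le_dist _
    · rw [integral_mul_const]
      push_cast
      exact mul_le_mul_of_nonneg_right hm dist_nonneg
  have hr : 0 ≤ r := by linarith [(dist_nonneg (x := x) (y := c))]
  have : Nonempty Z := ⟨⟨ContinuousMap.const _ c, fun t => by simp [hB, hr]⟩⟩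
  have : CompleteSpace Z := hZc.completeSpace_coe
  let u : Z := hcontr.fixedPoint F
  have hu : F u = u := hcontr.fixedPoint_isFixedPt
  refine ⟨fun t => u.1 (p t), hcont u.1, fun t _ => u.2 _, fun t ht => ?_⟩
  have h1 : (F u).1 ⟨t, ht⟩ = u.1 ⟨t, ht⟩ := by rw [hu]
  have h2 : u.1 (p t) = u.1 ⟨t, ht⟩ := by rw [hpI t ht]
  change u.1 (p t) = _
  rw [h2, ← h1]
  rfl

end Caratheodory

/-! ### Vector fields in charts -/

section Charts

variable {E : Type*} [NormedAddCommGroup E] [NormedSpace ℝ E]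
  {M : Type*} [TopologicalSpace M] [ChartedSpace E M] [IsManifold 𝓘(ℝ, E) ∞ M]

/-- The differential at `y` of the chart at `z`. -/
def chartD (z y : M) : TangentSpace 𝓘(ℝ, E) y →L[ℝ] E :=
  (trivializationAt E (TangentSpace 𝓘(ℝ, E)) z).continuousLinearMapAt ℝ y

/-- The inverse of the differential at `y` of the chart at `z`. -/
def chartDSymm (z y : M) : E →L[ℝ] TangentSpace 𝓘(ℝ, E) y :=
  (trivializationAt E (TangentSpace 𝓘(ℝ, E)) z).symmL ℝ y

theorem chartD_apply {z y : M} (hy : y ∈ (chartAt E z).source) (v : TangentSpace 𝓘(ℝ, E) y) :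
    chartD z y v = (trivializationAt E (TangentSpace 𝓘(ℝ, E)) z ⟨y, v⟩).2 := by
  unfold chartD
  rw [Trivialization.continuousLinearMapAt_apply, Trivialization.linearMapAt_apply,
    if_pos (by simpa using hy)]

theorem chartDSymm_chartD {z y : M} (hy : y ∈ (chartAt E z).source)
    (v : TangentSpace 𝓘(ℝ, E) y) : chartDSymm z y (chartD z y v) = v :=
  (trivializationAt E (TangentSpace 𝓘(ℝ, E)) z).symmL_continuousLinearMapAt (by simpa using hy) v

theorem chartD_eq_mfderiv {z y : M} (hy : y ∈ (chartAt E z).source) :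
    chartD (E := E) z y = mfderiv 𝓘(ℝ, E) 𝓘(ℝ, E) (extChartAt 𝓘(ℝ, E) z) y :=
  TangentBundle.continuousLinearMapAt_trivializationAt (E := E) (I := 𝓘(ℝ, E)) (𝕜 := ℝ) hy

theorem chartDSymm_eq_mfderiv {z y : M} (hy : y ∈ (chartAt E z).source) :
    chartDSymm (E := E) z y = mfderiv 𝓘(ℝ, E) 𝓘(ℝ, E) (extChartAt 𝓘(ℝ, E) z).symm
      (extChartAt 𝓘(ℝ, E) z y) := by
  have := TangentBundle.symmL_trivializationAt (E := E) (I := 𝓘(ℝ, E)) (𝕜 := ℝ) hy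
  simp only [modelWithCornersSelf_coe, range_id, mfderivWithin_univ] at this
  exact this

/-- The expression of a vector field in the chart at `z`, as a function on `M`. -/
def localRep (z : M) (ξ : (x : M) → TangentSpace 𝓘(ℝ, E) x) (y : M) : E := chartD z y (ξ y)

theorem localRep_sub (z : M) (ξ η : (x : M) → TangentSpace 𝓘(ℝ, E) x) (y : M) :
    localRep z (ξ - η) y = localRep z ξ y - localRep z η y :=
  map_sub (chartD z y) (ξ y) (η y)

theorem mdifferentiableAt_localRep_iff {z y : M} (hy : y ∈ (chartAt E z).source)
    (ξ : (x : M) → TangentSpace 𝓘(ℝ, E) x) :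
    MDifferentiableAt 𝓘(ℝ, E) (𝓘(ℝ, E).prod 𝓘(ℝ, E))
      (fun z => (⟨z, ξ z⟩ : TangentBundle 𝓘(ℝ, E) M)) y ↔
    MDifferentiableAt 𝓘(ℝ, E) 𝓘(ℝ, E) (localRep z ξ) y := by
  rw [(trivializationAt E (TangentSpace 𝓘(ℝ, E)) z).mdifferentiableAt_section_iff 𝓘(ℝ, E) ξ
    (by simpa using hy)]
  refine EventuallyEq.mdifferentiableAt_iff ?_
  filter_upwards [(chartAt E z).open_source.mem_nhds hy] with x hx
  exact (chartD_apply hx _).symm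

theorem hasFDerivAt_localRep_comp_symm {z : M} {ξ : (x : M) → TangentSpace 𝓘(ℝ, E) x} {u : E}
    (hu : u ∈ (extChartAt 𝓘(ℝ, E) z).target)
    (hξ : MDifferentiableAt 𝓘(ℝ, E) 𝓘(ℝ, E) (localRep z ξ) ((extChartAt 𝓘(ℝ, E) z).symm u)) :
    HasFDerivAt (fun e => localRep z ξ ((extChartAt 𝓘(ℝ, E) z).symm e))
      ((mvfderiv 𝓘(ℝ, E) (localRep z ξ) ((extChartAt 𝓘(ℝ, E) z).symm u)).comp
        (chartDSymm z ((extChartAt 𝓘(ℝ, E) z).symm u))) u := by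
  have hy : (extChartAt 𝓘(ℝ, E) z).symm u ∈ (chartAt E z).source := by
    simpa using (extChartAt 𝓘(ℝ, E) z).map_target hu
  have h1 : MDifferentiableAt 𝓘(ℝ, E) 𝓘(ℝ, E) (extChartAt 𝓘(ℝ, E) z).symm u := by
    have := mdifferentiableWithinAt_extChartAt_symm (I := 𝓘(ℝ, E)) hu
    simpa [mdifferentiableWithinAt_univ] using this
  have h2 := hξ.hasMFDerivAt.comp u h1.hasMFDerivAt
  have h3 := chartDSymm_eq_mfderiv (E := E) hy
  rw [(extChartAt 𝓘(ℝ, E) z).right_inv hu] at h3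
  rw [h3]
  exact h2.hasFDerivAt

/-- For smooth `σ`, `∇σ` is a continuous section of a Hom bundle, so its coordinate expression is
locally bounded. Applied to a coordinate frame, this bounds the Christoffel symbols. -/
theorem exists_norm_inCoordinates_le
    (nabla : CovariantDerivative 𝓘(ℝ, E) E (fun x : M => TangentSpace 𝓘(ℝ, E) x))
    (hsm : nabla.ContMDiffCovariantDerivative ∞) (z : M)
    {σ : (x : M) → TangentSpace 𝓘(ℝ, E) x}
    (hσ : ContMDiff 𝓘(ℝ, E) (𝓘(ℝ, E).prod 𝓘(ℝ, E)) ∞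
      (fun x => (⟨x, σ x⟩ : TangentBundle 𝓘(ℝ, E) M))) :
    ∃ C : ℝ, 0 ≤ C ∧ ∀ᶠ y in 𝓝 z, ∀ w : E,
      ‖chartD z y (nabla σ y (chartDSymm z y w))‖ ≤ C * ‖w‖ := by
  have h1 := hsm.contMDiff.contMDiff (σ := σ) (by simpa using hσ.contMDiffOn)
  have h2 := (h1.contMDiffAt (x := z) univ_mem)
  have h3 := ((contMDiffAt_hom_bundle _).1 h2).2.continuousAt.norm
  obtain ⟨C, hC⟩ : ∃ C : ℝ, ∀ᶠ y in 𝓝 z, ‖ContinuousLinearMap.inCoordinates E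
      (TangentSpace 𝓘(ℝ, E)) E (TangentSpace 𝓘(ℝ, E)) z y z y (nabla σ y)‖ < C :=
    ⟨_, h3.eventually (gt_mem_nhds (lt_add_one _))⟩
  refine ⟨max C 0, le_max_right _ _, hC.mono fun y hy w => ?_⟩
  refine (ContinuousLinearMap.le_opNorm (ContinuousLinearMap.inCoordinates E
    (TangentSpace 𝓘(ℝ, E)) E (TangentSpace 𝓘(ℝ, E)) z y z y (nabla σ y)) w).trans ?_
  gcongr
  exact hy.le.trans (le_max_left _ _)

variable [FiniteDimensional ℝ E] [T2Space M]

/-- In a chart, the covariant derivative differs from the derivative by a term of order zero. -/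
theorem exists_norm_mvfderiv_localRep_le
    (nabla : CovariantDerivative 𝓘(ℝ, E) E (fun x : M => TangentSpace 𝓘(ℝ, E) x))
    (hsm : nabla.ContMDiffCovariantDerivative ∞) (z : M) :
    ∃ C : ℝ, 0 ≤ C ∧ ∀ᶠ y in 𝓝 z, ∀ ξ : (x : M) → TangentSpace 𝓘(ℝ, E) x,
      MDifferentiableAt 𝓘(ℝ, E) (𝓘(ℝ, E).prod 𝓘(ℝ, E))
        (fun z => (⟨z, ξ z⟩ : TangentBundle 𝓘(ℝ, E) M)) y → ∀ w : E,
      ‖mvfderiv 𝓘(ℝ, E) (localRep z ξ) y (chartDSymm z y w)‖ ≤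
        ‖chartD z y (nabla ξ y (chartDSymm z y w))‖ + C * ‖localRep z ξ y‖ * ‖w‖ := by
  classical
  let e := trivializationAt E (TangentSpace 𝓘(ℝ, E) : M → Type _) z
  let b := Module.finBasis ℝ E
  let ρ : SmoothBumpFunction 𝓘(ℝ, E) z := Classical.arbitrary _
  -- The coordinate frame is cut off by a bump function to obtain globally smooth fields that still
  -- agree with the frame near `z`.
  let σ := fun i => (ρ : M → ℝ) • e.localFrame b i
  have hbase : e.baseSet = (chartAt E z).source := TangentBundle.trivializationAt_baseSet z
  have hσ : ∀ i, ContMDiff 𝓘(ℝ, E) (𝓘(ℝ, E).prod 𝓘(ℝ, E)) ∞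
      (fun x => (⟨x, σ i x⟩ : TangentBundle 𝓘(ℝ, E) M)) := by
    intro i
    refine ContMDiffOn.smul_section_of_tsupport (u := e.baseSet) ρ.contMDiff.contMDiffOn
      e.open_baseSet ?_ (e.contMDiffOn_localFrame_baseSet ∞ b i)
    rw [hbase]
    exact ρ.tsupport_subset_chartAt_source
  choose C hC0 hC using fun i => exists_norm_inCoordinates_le nabla hsm z (hσ i)
  let B : ℝ := ∑ i, ‖LinearMap.toContinuousLinearMap (b.coord i)‖ * C i
  refine ⟨B, Finset.sum_nonneg fun i _ => mul_nonneg (norm_nonneg _) (hC0 i), ?_⟩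
  filter_upwards [eventually_all.2 hC, ρ.eventuallyEq_one.eventually_nhds,
    (chartAt E z).open_source.mem_nhds (mem_chart_source E z)] with y hCy hρ hy ξ hξ w
  have hye : y ∈ e.baseSet := hbase ▸ hy
  have hξl : MDifferentiableAt 𝓘(ℝ, E) 𝓘(ℝ, E) (localRep z ξ) y :=
    (mdifferentiableAt_localRep_iff hy ξ).1 hξ
  let g : Fin (Module.finrank ℝ E) → M → ℝ := fun i x => b.coord i (localRep z ξ x)
  have hgd : ∀ i, HasMFDerivAt 𝓘(ℝ, E) 𝓘(ℝ, ℝ) (g i) y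
      ((LinearMap.toContinuousLinearMap (b.coord i)).comp
        (mfderiv 𝓘(ℝ, E) 𝓘(ℝ, E) (localRep z ξ) y)) := fun i =>
    ((LinearMap.toContinuousLinearMap (b.coord i)).hasFDerivAt.hasMFDerivAt).comp y
      hξl.hasMFDerivAt
  have hσy : ∀ i, MDifferentiableAt 𝓘(ℝ, E) (𝓘(ℝ, E).prod 𝓘(ℝ, E))
      (fun x => (⟨x, σ i x⟩ : TangentBundle 𝓘(ℝ, E) M)) y := fun i =>
    (hσ i y).mdifferentiableAt (by simp)
  have hgσ : ∀ i, MDifferentiableAt 𝓘(ℝ, E) (𝓘(ℝ, E).prod 𝓘(ℝ, E))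
      (fun x => (⟨x, (g i • σ i) x⟩ : TangentBundle 𝓘(ℝ, E) M)) y := fun i =>
    (hgd i).mdifferentiableAt.smul_section (hσy i)
  have hsum : ∀ s : Finset (Fin (Module.finrank ℝ E)),
      MDifferentiableAt 𝓘(ℝ, E) (𝓘(ℝ, E).prod 𝓘(ℝ, E))
        (fun x => (⟨x, (∑ i ∈ s, g i • σ i) x⟩ : TangentBundle 𝓘(ℝ, E) M)) y ∧
      nabla (∑ i ∈ s, g i • σ i) y = ∑ i ∈ s, nabla (g i • σ i) y := by
    intro s
    induction s using Finset.induction_on with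
    | empty =>
      refine ⟨?_, by simp⟩
      simpa using! mdifferentiableAt_zeroSection ℝ (TangentSpace 𝓘(ℝ, E) : M → Type _) (x := y)
    | insert i s hi ih =>
      rw [Finset.sum_insert hi, Finset.sum_insert hi, ← ih.2]
      exact ⟨mdifferentiableAt_add_section (hgσ i) ih.1,
        nabla.isCovariantDerivativeOnUniv.add (hgσ i) ih.1⟩
  -- The bump function equals `1` on a whole neighbourhood of `y`, so `ξ` and its frame expansion
  -- have the same germ and hence the same covariant derivative at `y`. The coefficients `g i` need
  -- only be differentiable at `y` for the Leibniz rule.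
  have heq : ∀ᶠ x in 𝓝 y, ξ x = (∑ i, g i • σ i) x := by
    filter_upwards [hρ, e.open_baseSet.mem_nhds hye] with x hx hxe
    rw [e.eq_sum_localFrameCoeff_smul (I := 𝓘(ℝ, E)) (b := b) (s := ξ) hxe]
    simp only [Finset.sum_apply, Pi.smul_apply', σ, hx, Pi.one_apply, one_smul, g]
    refine Finset.sum_congr rfl fun i _ => ?_
    congr 1
    rw [e.localFrameCoeff_eq_coeff hxe]
    simp only [localRep, Module.Basis.coord_apply]
    rw [chartD_apply (hbase ▸ hxe)]
  have hnab : nabla ξ y = ∑ i, (g i y • nabla (σ i) y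
      + (mvfderiv 𝓘(ℝ, E) (g i) y).smulRight (σ i y)) := by
    rw [nabla.isCovariantDerivativeOnUniv.congr_of_eventuallyEq hξ (hsum Finset.univ).1 univ_mem heq,
      (hsum Finset.univ).2]
    exact Finset.sum_congr rfl fun i _ =>
      nabla.isCovariantDerivativeOnUniv.leibniz (hσy i) (hgd i).mdifferentiableAt
  have hσv : ∀ i, chartD z y (σ i y) = b i := by
    intro i
    have : ρ y = 1 := hρ.self_of_nhds
    simp only [σ, Pi.smul_apply', this, one_smul, e.localFrame_apply_of_mem_baseSet b hye]
    rw [chartD_apply hy]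
    have h1 : e.basisAt b hye i = e.symm y (b i) := by simp [Trivialization.basisAt]
    rw [h1, e.apply_mk_symm hye]
  -- The sum is the Christoffel term. It involves `ξ` only through the values `g i y`, which gives
  -- the order-zero bound.
  have hmain : mvfderiv 𝓘(ℝ, E) (localRep z ξ) y (chartDSymm z y w) =
      chartD z y (nabla ξ y (chartDSymm z y w)) -
        ∑ i, g i y • chartD z y (nabla (σ i) y (chartDSymm z y w)) := by
    rw [hnab]
    simp only [_root_.sum_apply, _root_.add_apply,
      _root_.smul_apply, ContinuousLinearMap.smulRight_apply, map_sum, map_add,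
      map_smul, hσv, Finset.sum_add_distrib, add_sub_cancel_left]
    rw [← b.sum_repr (mvfderiv 𝓘(ℝ, E) (localRep z ξ) y (chartDSymm z y w))]
    refine Finset.sum_congr rfl fun i _ => ?_
    congr 1
    simp only [mvfderiv, (hgd i).mfderiv]
    rfl
  rw [hmain]
  refine (norm_sub_le _ _).trans (add_le_add le_rfl ?_)
  refine (norm_sum_le _ _).trans ?_
  rw [Finset.sum_mul, Finset.sum_mul]
  refine Finset.sum_le_sum fun i _ => ?_
  rw [norm_smul]
  calc ‖g i y‖ * ‖chartD z y (nabla (σ i) y (chartDSymm z y w))‖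
      ≤ (‖LinearMap.toContinuousLinearMap (b.coord i)‖ * ‖localRep z ξ y‖) * (C i * ‖w‖) := by
        gcongr
        · exact (LinearMap.toContinuousLinearMap (b.coord i)).le_opNorm _
        · exact hCy i w
    _ = _ := by ring

end Charts

/-! ### The seminorms `p_K^lip` control the Lipschitz constants in charts -/

section ChartEstimate

variable {E : Type*} [NormedAddCommGroup E] [NormedSpace ℝ E]
  {M : Type*} [TopologicalSpace M] [ChartedSpace E M] [IsManifold 𝓘(ℝ, E) ∞ M]

/-- The expression of a vector field in the chart at `z`, as a function on the model space. -/
def chartRep (z : M) (ξ : (x : M) → TangentSpace 𝓘(ℝ, E) x) (u : E) : E :=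
  localRep z ξ ((extChartAt 𝓘(ℝ, E) z).symm u)

theorem IsLipSection.sub {ξ η : (x : M) → TangentSpace 𝓘(ℝ, E) x} (hξ : IsLipSection ξ)
    (hη : IsLipSection η) : IsLipSection (ξ - η) := by
  intro x
  obtain ⟨C, U, hU, hC⟩ := hξ x
  obtain ⟨D, V, hV, hD⟩ := hη x
  refine ⟨C + D, U ∩ V ∩ (chartAt E x).source, inter_mem (inter_mem hU hV)
    (chart_source_mem_nhds E x), fun y hy z hz => ?_⟩
  have h1 := hC y hy.1.1 z hz.1.1
  have h2 := hD y hy.1.2 z hz.1.2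
  rw [← chartD_apply hy.2, ← chartD_apply hz.2] at h1 h2 ⊢
  have e1 : chartD x y ((ξ - η) y) = chartD x y (ξ y) - chartD x y (η y) := map_sub _ _ _
  have e2 : chartD x z ((ξ - η) z) = chartD x z (ξ z) - chartD x z (η z) := map_sub _ _ _
  rw [e1, e2, sub_sub_sub_comm, NNReal.coe_add, add_mul]
  exact (norm_sub_le _ _).trans (add_le_add h1 h2)

/-- `IsLipSection` speaks at each point only of the chart centred there. Passing to the fixed chart
at `z` applies the coordinate change `A`, which is `C^1`, to the Lipschitz representative `B`;
evaluation `(A, B) ↦ A B` is bilinear and hence locally Lipschitz. -/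
theorem IsLipSection.locallyLipschitzOn_chartRep {ξ : (x : M) → TangentSpace 𝓘(ℝ, E) x}
    (hξ : IsLipSection ξ) (z : M) :
    ∀ u ∈ (extChartAt 𝓘(ℝ, E) z).target, ∃ K : ℝ≥0, ∃ U ∈ 𝓝 u,
      LipschitzOnWith K (chartRep z ξ) U := by
  intro u hu
  set φ := extChartAt 𝓘(ℝ, E) z with hφ
  set y := φ.symm u with hy
  have hyz : y ∈ φ.source := φ.map_target hu
  have hto : IsOpen φ.target := isOpen_extChartAt_target z
  have hsymm : ContMDiffAt 𝓘(ℝ, E) 𝓘(ℝ, E) ∞ φ.symm u :=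
    (contMDiffOn_extChartAt_symm (n := ∞) (I := 𝓘(ℝ, E)) z).contMDiffAt (hto.mem_nhds hu)
  let e := trivializationAt E (TangentSpace 𝓘(ℝ, E) : M → Type _) y
  let e' := trivializationAt E (TangentSpace 𝓘(ℝ, E) : M → Type _) z
  let A : E → E →L[ℝ] E := fun u => (e.coordChangeL ℝ e' (φ.symm u) : E →L[ℝ] E)
  have hbe : e.baseSet = (chartAt E y).source := TangentBundle.trivializationAt_baseSet y
  have hbe' : e'.baseSet = (chartAt E z).source := TangentBundle.trivializationAt_baseSet z
  have hye : y ∈ e.baseSet ∩ e'.baseSet :=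
    ⟨hbe ▸ mem_chart_source E y, by rw [hbe']; simpa [hφ] using hyz⟩
  have hA : ContDiffAt ℝ 1 A u := by
    have h1 := (contMDiffOn_coordChangeL (n := ∞) (IB := 𝓘(ℝ, E)) e e').contMDiffAt
      ((e.open_baseSet.inter e'.open_baseSet).mem_nhds hye)
    have h2 : ContMDiffAt 𝓘(ℝ, E) 𝓘(ℝ, E →L[ℝ] E) ∞ A u := h1.comp u hsymm
    exact h2.contDiffAt.of_le (by simp)
  have hψ : ContDiffAt ℝ 1 (fun v => extChartAt 𝓘(ℝ, E) y (φ.symm v)) u := by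
    have h1 : ContMDiffAt 𝓘(ℝ, E) 𝓘(ℝ, E) ∞ (extChartAt 𝓘(ℝ, E) y) y := contMDiffAt_extChartAt
    have h2 : ContMDiffAt 𝓘(ℝ, E) 𝓘(ℝ, E) ∞ (extChartAt 𝓘(ℝ, E) y ∘ φ.symm) u := h1.comp u hsymm
    exact h2.contDiffAt.of_le (by simp)
  obtain ⟨KA, UA, hUA, hLA⟩ := hA.exists_lipschitzOnWith
  obtain ⟨Kψ, Uψ, hUψ, hLψ⟩ := hψ.exists_lipschitzOnWith
  obtain ⟨C, V, hV, hC⟩ := hξ y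
  have hcs : ContinuousAt φ.symm u := hsymm.continuousAt
  have hW : φ.symm ⁻¹' (V ∩ (e.baseSet ∩ e'.baseSet)) ∈ 𝓝 u :=
    hcs.preimage_mem_nhds (inter_mem hV ((e.open_baseSet.inter e'.open_baseSet).mem_nhds hye))
  let B : E → E := fun v => localRep y ξ (φ.symm v)
  have hB : LipschitzOnWith (C * Kψ) B (Uψ ∩ φ.symm ⁻¹' (V ∩ (e.baseSet ∩ e'.baseSet))) := by
    refine LipschitzOnWith.of_dist_le_mul fun v hv w hw => ?_
    have h1 := hC _ hv.2.1 _ hw.2.1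
    rw [← chartD_apply (hbe ▸ hv.2.2.1), ← chartD_apply (hbe ▸ hw.2.2.1)] at h1
    have h2 := hLψ.dist_le_mul v hv.1 w hw.1
    rw [dist_eq_norm]
    refine h1.trans ?_
    rw [NNReal.coe_mul, mul_assoc]
    gcongr
    rwa [dist_eq_norm] at h2
  have hG : ContDiffAt ℝ 1 (fun p : (E →L[ℝ] E) × E => p.1 p.2) (A u, B u) :=
    (isBoundedBilinearMap_apply (𝕜 := ℝ) (E := E) (F := E)).contDiff.contDiffAt
  obtain ⟨KG, UG, hUG, hLG⟩ := hG.exists_lipschitzOnWith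
  have hBc : ContinuousAt B u := hB.continuousOn.continuousAt (inter_mem hUψ hW)
  have hAB : (fun v => (A v, B v)) ⁻¹' UG ∈ 𝓝 u :=
    (hA.continuousAt.prodMk hBc).preimage_mem_nhds hUG
  refine ⟨KG * max KA (C * Kψ), _, inter_mem (inter_mem hUA (inter_mem hUψ hW)) hAB, ?_⟩
  have hpair := (hLA.mono (s := UA ∩ (Uψ ∩ φ.symm ⁻¹' (V ∩ (e.baseSet ∩ e'.baseSet))))
    inter_subset_left).prodMk (hB.mono inter_subset_right)
  have hcomp := hLG.comp (hpair.mono (inter_subset_left (t := (fun v => (A v, B v)) ⁻¹' UG)))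
    (fun v hv => hv.2)
  intro v hv w hw
  have key : ∀ v ∈ φ.symm ⁻¹' (V ∩ (e.baseSet ∩ e'.baseSet)), chartRep z ξ v = A v (B v) := by
    intro v hv
    have h1 : φ.symm v ∈ (chartAt E z).source := hbe' ▸ hv.2.2
    have h2 : φ.symm v ∈ (chartAt E y).source := hbe ▸ hv.2.1
    change chartD z _ _ = (e.coordChangeL ℝ e' (φ.symm v)) (chartD y (φ.symm v) (ξ (φ.symm v)))
    have h3 : e.symm (φ.symm v) (chartD y (φ.symm v) (ξ (φ.symm v))) = ξ (φ.symm v) := by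
      have := chartDSymm_chartD h2 (ξ (φ.symm v))
      rw [chartDSymm, Trivialization.symmL_apply] at this
      · exact this
      · exact hv.2.1
    rw [e.coordChangeL_apply e' hv.2, h3, chartD_apply h1]
  rw [key v hv.1.2.2, key w hw.1.2.2]
  exact hcomp hv hw

variable [FiniteDimensional ℝ E] [T2Space M]
  [RiemannianBundle (fun x : M => TangentSpace 𝓘(ℝ, E) x)]
  [IsContinuousRiemannianBundle E (fun x : M => TangentSpace 𝓘(ℝ, E) x)]

theorem exists_norm_chartD_le (z : M) : ∃ C : ℝ, 0 < C ∧ ∀ᶠ y in 𝓝 z,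
    (∀ v : TangentSpace 𝓘(ℝ, E) y, ‖chartD z y v‖ ≤ C * ‖v‖) ∧
    ∀ w : E, ‖chartDSymm z y w‖ ≤ C * ‖w‖ := by
  obtain ⟨C, hC, h1⟩ :=
    eventually_norm_trivializationAt_lt E (fun x : M => TangentSpace 𝓘(ℝ, E) x) z
  obtain ⟨D, hD, h2⟩ :=
    eventually_norm_symmL_trivializationAt_lt E (fun x : M => TangentSpace 𝓘(ℝ, E) x) z
  refine ⟨max C D, lt_max_of_lt_left hC, ?_⟩
  filter_upwards [h1, h2] with y hy1 hy2
  refine ⟨fun v => ?_, fun w => ?_⟩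
  · refine (ContinuousLinearMap.le_opNorm
      ((trivializationAt E (TangentSpace 𝓘(ℝ, E)) z).continuousLinearMapAt ℝ y) v).trans ?_
    gcongr
    exact hy1.le.trans (le_max_left _ _)
  · refine (ContinuousLinearMap.le_opNorm
      ((trivializationAt E (TangentSpace 𝓘(ℝ, E)) z).symmL ℝ y) w).trans ?_
    gcongr
    exact hy2.le.trans (le_max_right _ _)

variable (nabla : CovariantDerivative 𝓘(ℝ, E) E (fun x : M => TangentSpace 𝓘(ℝ, E) x))

theorem norm_le_pLip {K : Set M} {ξ : (x : M) → TangentSpace 𝓘(ℝ, E) x}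
    (hfin : pLip nabla K ξ ≠ ⊤) {y : M} (hy : y ∈ K) : ‖ξ y‖ ≤ (pLip nabla K ξ).toReal := by
  have h1 : ‖ξ y‖ₑ ≤ pLip nabla K ξ :=
    (le_iSup₂ (f := fun x (_ : x ∈ K) => ‖ξ x‖ₑ) y hy).trans (le_max_right _ _)
  have := ENNReal.toReal_mono hfin h1
  simpa using this

/-- The point `y` lies in the closure of every neighbourhood over which the infimum in `dil` runs,
so each supremum already dominates the value at `y`. Homogeneity removes the restriction to unit
vectors. -/
theorem norm_nabla_le_pLip {K : Set M} {ξ : (x : M) → TangentSpace 𝓘(ℝ, E) x}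
    (hfin : pLip nabla K ξ ≠ ⊤) {y : M} (hy : y ∈ K)
    (hξ : MDifferentiableAt 𝓘(ℝ, E) (𝓘(ℝ, E).prod 𝓘(ℝ, E))
      (fun z => (⟨z, ξ z⟩ : TangentBundle 𝓘(ℝ, E) M)) y) (v : TangentSpace 𝓘(ℝ, E) y) :
    ‖nabla ξ y v‖ ≤ (pLip nabla K ξ).toReal * ‖v‖ := by
  have hunit : ∀ v : TangentSpace 𝓘(ℝ, E) y, ‖v‖ = 1 →
      ‖nabla ξ y v‖ ≤ (pLip nabla K ξ).toReal := by
    intro v hv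
    have h1 : ‖nabla ξ y v‖ₑ ≤ dil nabla ξ y := by
      refine le_iInf fun U => le_iInf fun hU => le_iInf fun _ => ?_
      exact le_iSup_of_le y <| le_iSup_of_le (subset_closure (mem_of_mem_nhds hU)) <|
        le_iSup_of_le hξ <| le_iSup_of_le v <| le_iSup_of_le hv le_rfl
    have h2 : dil nabla ξ y ≤ pLip nabla K ξ :=
      (le_iSup₂ (f := fun x (_ : x ∈ K) => dil nabla ξ x) y hy).trans (le_max_left _ _)
    have := ENNReal.toReal_mono hfin (h1.trans h2)
    simpa using this
  rcases eq_or_ne v 0 with rfl | hv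
  · simp
  · have hv' : ‖v‖ ≠ 0 := norm_ne_zero_iff.2 hv
    have h1 := hunit (‖v‖⁻¹ • v) (by rw [norm_smul]; simp [hv'])
    rw [map_smul, norm_smul, norm_inv, norm_norm, inv_mul_le_iff₀ (by positivity)] at h1
    rwa [mul_comm]

/-- In a small ball around the centre of a chart, the local representative of a locally Lipschitz
vector field is bounded and Lipschitz, with constants controlled by `p_K^lip`. -/
theorem exists_chartRep_lipschitz (hsm : nabla.ContMDiffCovariantDerivative ∞) (z : M) :
    ∃ C : ℝ, 0 ≤ C ∧ ∀ᶠ r in 𝓝[>] (0 : ℝ), ∀ ξ : (x : M) → TangentSpace 𝓘(ℝ, E) x,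
      IsLipSection ξ → ∀ K : Set M, K = (extChartAt 𝓘(ℝ, E) z).symm ''
        Metric.closedBall (extChartAt 𝓘(ℝ, E) z z) r → pLip nabla K ξ ≠ ⊤ →
      (∀ u ∈ Metric.closedBall (extChartAt 𝓘(ℝ, E) z z) r,
        ‖chartRep z ξ u‖ ≤ C * (pLip nabla K ξ).toReal) ∧
      ∀ u ∈ Metric.closedBall (extChartAt 𝓘(ℝ, E) z z) r,
        ∀ v ∈ Metric.closedBall (extChartAt 𝓘(ℝ, E) z z) r,
        ‖chartRep z ξ u - chartRep z ξ v‖ ≤ C * (pLip nabla K ξ).toReal * ‖u - v‖ := by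
  set φ := extChartAt 𝓘(ℝ, E) z with hφ
  obtain ⟨C₁, hC₁, h1⟩ := exists_norm_chartD_le (E := E) z
  obtain ⟨C₂, hC₂, h2⟩ := exists_norm_mvfderiv_localRep_le nabla hsm z
  have hto : IsOpen φ.target := isOpen_extChartAt_target z
  have hct : φ z ∈ φ.target := mem_extChartAt_target z
  have hev : ∀ᶠ u in 𝓝 (φ z), u ∈ φ.target ∧
      (∀ v : TangentSpace 𝓘(ℝ, E) (φ.symm u), ‖chartD z (φ.symm u) v‖ ≤ C₁ * ‖v‖) ∧
      (∀ w : E, ‖chartDSymm z (φ.symm u) w‖ ≤ C₁ * ‖w‖) ∧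
      ∀ ξ : (x : M) → TangentSpace 𝓘(ℝ, E) x,
        MDifferentiableAt 𝓘(ℝ, E) (𝓘(ℝ, E).prod 𝓘(ℝ, E))
          (fun z => (⟨z, ξ z⟩ : TangentBundle 𝓘(ℝ, E) M)) (φ.symm u) → ∀ w : E,
        ‖mvfderiv 𝓘(ℝ, E) (localRep z ξ) (φ.symm u) (chartDSymm z (φ.symm u) w)‖ ≤
          ‖chartD z (φ.symm u) (nabla ξ (φ.symm u) (chartDSymm z (φ.symm u) w))‖
            + C₂ * ‖localRep z ξ (φ.symm u)‖ * ‖w‖ := by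
    have hcs : Tendsto φ.symm (𝓝 (φ z)) (𝓝 z) := by
      have := (continuousAt_extChartAt_symm (I := 𝓘(ℝ, E)) z).tendsto
      rwa [extChartAt_to_inv] at this
    filter_upwards [hto.mem_nhds hct, hcs.eventually h1, hcs.eventually h2] with u hu h1 h2
    exact ⟨hu, h1.1, h1.2, h2⟩
  obtain ⟨r₀, hr₀, hball⟩ := Metric.eventually_nhds_iff_ball.1 hev
  have hC0 : 0 ≤ C₁ + (C₁ * C₁ + C₂ * C₁) := by positivity
  -- `C₁` serves the values of the representative, `C₁ * C₁` the covariant derivative read in the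
  -- chart, and `C₂ * C₁` the order-zero correction.
  refine ⟨C₁ + (C₁ * C₁ + C₂ * C₁), hC0, ?_⟩
  filter_upwards [Ioo_mem_nhdsGT hr₀] with r hr ξ hξ K hK hfin
  set L := (pLip nabla K ξ).toReal with hL
  have hL0 : 0 ≤ L := ENNReal.toReal_nonneg
  have hsub : Metric.closedBall (φ z) r ⊆ Metric.ball (φ z) r₀ :=
    Metric.closedBall_subset_ball hr.2
  have hmemK : ∀ u ∈ Metric.closedBall (φ z) r, φ.symm u ∈ K := fun u hu =>
    hK ▸ mem_image_of_mem _ hu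
  have hbd : ∀ u ∈ Metric.closedBall (φ z) r, ‖chartRep z ξ u‖ ≤ C₁ * L := fun u hu =>
    ((hball u (hsub hu)).2.1 _).trans
      (mul_le_mul_of_nonneg_left (norm_le_pLip nabla hfin (hmemK u hu)) hC₁.le)
  refine ⟨fun u hu => (hbd u hu).trans ?_, ?_⟩
  · gcongr
    nlinarith [mul_nonneg hC₂ hC₁.le]
  -- Lipschitz on the closed ball with some constant, hence extendable
  obtain ⟨K₁, hK₁⟩ : ∃ K₁ : ℝ≥0, LipschitzOnWith K₁ (chartRep z ξ) (Metric.closedBall (φ z) r) := by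
    refine LocallyLipschitzOn.exists_lipschitzOnWith_of_compact (isCompact_closedBall _ _) ?_
    intro u hu
    obtain ⟨K', U, hU, h⟩ := hξ.locallyLipschitzOn_chartRep z u (hball u (hsub hu)).1
    exact ⟨K', U, mem_nhdsWithin_of_mem_nhds hU, h⟩
  obtain ⟨g, hg, hgeq⟩ := hK₁.extend_finite_dimension
  have hder : ∀ u ∈ Metric.ball (φ z) r, DifferentiableAt ℝ g u → ∀ w,
      ‖fderiv ℝ g u w‖ ≤ (C₁ + (C₁ * C₁ + C₂ * C₁)) * L * ‖w‖ := by
    intro u hu hd w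
    have huc := Metric.ball_subset_closedBall hu
    obtain ⟨hut, hb1, hb2, hb3⟩ := hball u (hsub huc)
    have hloc : g =ᶠ[𝓝 u] chartRep z ξ := by
      filter_upwards [Metric.isOpen_ball.mem_nhds hu] with v hv
      exact (hgeq (Metric.ball_subset_closedBall hv)).symm
    have hd' : DifferentiableAt ℝ (chartRep z ξ) u := hloc.differentiableAt_iff.1 hd
    have hy : φ.symm u ∈ (chartAt E z).source := by simpa [hφ] using φ.map_target hut
    have hmd : MDifferentiableAt 𝓘(ℝ, E) 𝓘(ℝ, E) (localRep z ξ) (φ.symm u) := by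
      have e1 : localRep z ξ =ᶠ[𝓝 (φ.symm u)] chartRep z ξ ∘ φ := by
        filter_upwards [(chartAt E z).open_source.mem_nhds hy] with x hx
        have : φ.symm (φ x) = x := φ.left_inv (by simpa [hφ] using hx)
        change localRep z ξ x = localRep z ξ (φ.symm (φ x))
        rw [this]
      refine MDifferentiableAt.congr_of_eventuallyEq ?_ e1
      have h3 : MDifferentiableAt 𝓘(ℝ, E) 𝓘(ℝ, E) φ (φ.symm u) :=
        mdifferentiableAt_extChartAt hy
      have h4 : MDifferentiableAt 𝓘(ℝ, E) 𝓘(ℝ, E) (chartRep z ξ) (φ (φ.symm u)) := by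
        rw [φ.right_inv hut]; exact hd'.mdifferentiableAt
      exact h4.comp _ h3
    have hfd := hasFDerivAt_localRep_comp_symm hut hmd
    have hξd := (mdifferentiableAt_localRep_iff hy ξ).2 hmd
    rw [hloc.fderiv_eq, HasFDerivAt.fderiv (f := chartRep z ξ) hfd]
    refine (hb3 ξ hξd w).trans ?_
    have k1 : ‖chartD z (φ.symm u) (nabla ξ (φ.symm u) (chartDSymm z (φ.symm u) w))‖
        ≤ C₁ * (L * (C₁ * ‖w‖)) := by
      refine (hb1 _).trans (mul_le_mul_of_nonneg_left ?_ hC₁.le)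
      refine (norm_nabla_le_pLip nabla hfin (hmemK u huc) hξd _).trans ?_
      exact mul_le_mul_of_nonneg_left (hb2 w) hL0
    have k2 : C₂ * ‖localRep z ξ (φ.symm u)‖ * ‖w‖ ≤ C₂ * (C₁ * L) * ‖w‖ := by
      gcongr
      exact hbd u huc
    have k3 : 0 ≤ C₁ * L * ‖w‖ := by positivity
    calc _ ≤ C₁ * (L * (C₁ * ‖w‖)) + C₂ * (C₁ * L) * ‖w‖ := add_le_add k1 k2
      _ ≤ _ := by linarith
  borelize E
  -- The seminorm only sees points where `ξ` is differentiable. By Rademacher's theorem for the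
  -- extension `g` these fill almost all of the open ball; the closed ball is reached by continuity.
  have hlip := lipschitzOnWith_of_ae_norm_fderiv_le (Measure.addHaar : Measure E) hg
    Metric.isOpen_ball (convex_ball (φ z) r) (L := (C₁ + (C₁ * C₁ + C₂ * C₁)) * L)
    (by filter_upwards [hg.ae_differentiableAt (μ := Measure.addHaar)] with u hu hub w
        exact hder u hub hu w)
  have hlipg : LipschitzOnWith ((C₁ + (C₁ * C₁ + C₂ * C₁)) * L).toNNReal g
      (Metric.ball (φ z) r) := by
    refine LipschitzOnWith.of_dist_le_mul fun u hu v hv => ?_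
    rw [Real.coe_toNNReal _ (by positivity), dist_eq_norm, dist_eq_norm]
    exact hlip u hu v hv
  have hlipc := hlipg.closure hg.continuous.continuousOn
  rw [closure_ball _ hr.1.ne'] at hlipc
  intro u hu v hv
  have := hlipc.dist_le_mul u hu v hv
  rw [Real.coe_toNNReal _ (by positivity), dist_eq_norm, dist_eq_norm, ← hgeq hu, ← hgeq hv] at this
  exact this

end ChartEstimate

/-! ### The Riemannian distance in charts -/

section Distance

variable {E : Type*} [NormedAddCommGroup E] [NormedSpace ℝ E]
  {M : Type*} [TopologicalSpace M] [ChartedSpace E M] [IsManifold 𝓘(ℝ, E) ∞ M]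

theorem hasDerivWithinAt_extChartAt_comp {z : M} {γ : ℝ → M} {s : Set ℝ} {t : ℝ}
    {v : TangentSpace 𝓘(ℝ, E) (γ t)}
    (h : HasMFDerivWithinAt 𝓘(ℝ, ℝ) 𝓘(ℝ, E) γ s t ((1 : ℝ →L[ℝ] ℝ).smulRight v))
    (hγ : γ t ∈ (chartAt E z).source) :
    HasDerivWithinAt (fun t => extChartAt 𝓘(ℝ, E) z (γ t)) (chartD z (γ t) v) s t := by
  have h1 := (mdifferentiableAt_extChartAt (I := 𝓘(ℝ, E)) hγ).hasMFDerivAt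
  rw [chartD_eq_mfderiv (E := E) hγ]
  let A : ℝ →L[ℝ] E := (mfderiv 𝓘(ℝ, E) 𝓘(ℝ, E) (extChartAt 𝓘(ℝ, E) z) (γ t)).comp
    ((1 : ℝ →L[ℝ] ℝ).smulRight v)
  have h2 : HasFDerivWithinAt (fun t => extChartAt 𝓘(ℝ, E) z (γ t)) A s t :=
    (h1.comp_hasMFDerivWithinAt t h).hasFDerivWithinAt
  have hA : A 1 = mfderiv 𝓘(ℝ, E) 𝓘(ℝ, E) (extChartAt 𝓘(ℝ, E) z) (γ t) v :=
    congrArg (mfderiv 𝓘(ℝ, E) 𝓘(ℝ, E) (extChartAt 𝓘(ℝ, E) z) (γ t)) (one_smul ℝ v)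
  exact h2.hasDerivWithinAt.congr_deriv hA

theorem hasMFDerivWithinAt_extChartAt_symm_comp {z : M} {c : ℝ → E} {s : Set ℝ} {t : ℝ} {w : E}
    (h : HasDerivWithinAt c w s t) (hc : c t ∈ (extChartAt 𝓘(ℝ, E) z).target) :
    HasMFDerivWithinAt 𝓘(ℝ, ℝ) 𝓘(ℝ, E) (fun t => (extChartAt 𝓘(ℝ, E) z).symm (c t)) s t
      ((1 : ℝ →L[ℝ] ℝ).smulRight (chartDSymm z ((extChartAt 𝓘(ℝ, E) z).symm (c t)) w)) := by
  have hy : (extChartAt 𝓘(ℝ, E) z).symm (c t) ∈ (chartAt E z).source := by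
    simpa using (extChartAt 𝓘(ℝ, E) z).map_target hc
  have h1 : MDifferentiableAt 𝓘(ℝ, E) 𝓘(ℝ, E) (extChartAt 𝓘(ℝ, E) z).symm (c t) := by
    have := mdifferentiableWithinAt_extChartAt_symm (I := 𝓘(ℝ, E)) hc
    simpa [mdifferentiableWithinAt_univ] using this
  have h2 := h1.hasMFDerivAt.comp_hasMFDerivWithinAt t h.hasFDerivWithinAt.hasMFDerivWithinAt
  have h3 := chartDSymm_eq_mfderiv (E := E) hy
  rw [(extChartAt 𝓘(ℝ, E) z).right_inv hc] at h3
  rw [h3]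
  refine h2.congr_mfderiv ?_
  refine ContinuousLinearMap.ext_ring ?_
  change mfderiv 𝓘(ℝ, E) 𝓘(ℝ, E) (extChartAt 𝓘(ℝ, E) z).symm (c t) ((1 : ℝ) • w) =
    (1 : ℝ) • mfderiv 𝓘(ℝ, E) 𝓘(ℝ, E) (extChartAt 𝓘(ℝ, E) z).symm (c t) w
  exact map_smul _ _ _

variable [T2Space M] [FiniteDimensional ℝ E] [RiemannianBundle (fun x : M => TangentSpace 𝓘(ℝ, E) x)]
  [IsContinuousRiemannianBundle E (fun x : M => TangentSpace 𝓘(ℝ, E) x)]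

/-- Near a point, the Riemannian distance is bounded by the distance in the chart. -/
theorem exists_riemannianEDist_le (z : M) : ∃ C : ℝ≥0, ∃ V ∈ 𝓝 z, ∀ x ∈ V, ∀ y ∈ V,
    Manifold.riemannianEDist 𝓘(ℝ, E) x y
      ≤ C * edist (extChartAt 𝓘(ℝ, E) z x) (extChartAt 𝓘(ℝ, E) z y) := by
  set φ := extChartAt 𝓘(ℝ, E) z with hφ
  obtain ⟨C, hC, h1⟩ := exists_norm_chartD_le (E := E) z
  lift C to ℝ≥0 using hC.le
  have hcs : Tendsto φ.symm (𝓝 (φ z)) (𝓝 z) := by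
    have := (continuousAt_extChartAt_symm (I := 𝓘(ℝ, E)) z).tendsto
    rwa [extChartAt_to_inv] at this
  obtain ⟨r, hr, hball⟩ := Metric.eventually_nhds_iff_ball.1
    ((((isOpen_extChartAt_target (I := 𝓘(ℝ, E)) z).eventually_mem (mem_extChartAt_target z))).and
      (hcs.eventually h1))
  refine ⟨C, φ.source ∩ φ ⁻¹' Metric.ball (φ z) r,
    inter_mem (extChartAt_source_mem_nhds z)
      ((continuousAt_extChartAt z).preimage_mem_nhds (Metric.ball_mem_nhds _ hr)), ?_⟩
  intro x hx y hy
  -- The competitor is the straight segment in the chart, which stays in the ball by convexity.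
  let c : ℝ → E := fun t => φ x + t • (φ y - φ x)
  have hc : ∀ t ∈ Icc (0 : ℝ) 1, c t ∈ Metric.ball (φ z) r := fun t ht =>
    (convex_ball (φ z) r).add_smul_sub_mem hx.2 hy.2 ht
  have hcd : ∀ t, HasDerivAt c (φ y - φ x) t := fun t => by
    have := ((hasDerivAt_id t).smul_const (φ y - φ x)).const_add (φ x)
    rwa [one_smul] at this
  have hsmooth : ContMDiffOn 𝓘(ℝ, ℝ) 𝓘(ℝ, E) 1 (fun t => φ.symm (c t)) (Icc 0 1) := by
    refine (contMDiffOn_extChartAt_symm (n := 1) (I := 𝓘(ℝ, E)) z).comp (t := φ.target)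
      (f := c) ?_ fun t ht => (hball _ (hc t ht)).1
    rw [contMDiffOn_iff_contDiffOn]
    fun_prop
  have h2 := Manifold.riemannianEDist_le_pathELength hsmooth
    (x := x) (y := y) (by simp [c, φ.left_inv hx.1]) (by simp [c, φ.left_inv hy.1]) zero_le_one
  refine h2.trans ?_
  rw [Manifold.pathELength_eq_lintegral_mfderivWithin_Icc]
  calc _ ≤ ∫⁻ t in Icc (0 : ℝ) 1, (C : ℝ≥0∞) * edist (φ x) (φ y) := by
        refine setLIntegral_mono' measurableSet_Icc fun t ht => ?_
        have hd := hasMFDerivWithinAt_extChartAt_symm_comp (hcd t).hasDerivWithinAt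
          (s := Icc 0 1) (hball _ (hc t ht)).1
        rw [hd.mfderivWithin (uniqueMDiffWithinAt_iff_uniqueDiffWithinAt.2
          (uniqueDiffOn_Icc zero_lt_one t ht))]
        have h3 := (hball _ (hc t ht)).2.2 (φ y - φ x)
        rw [edist_comm, edist_eq_enorm_sub]
        have h4 : ‖chartDSymm z (φ.symm (c t)) (φ y - φ x)‖ₑ ≤ C * ‖φ y - φ x‖ₑ := by
          simp only [enorm, ← ENNReal.coe_mul, ENNReal.coe_le_coe, ← NNReal.coe_le_coe]
          exact h3
        refine le_trans (le_of_eq ?_) h4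
        exact congrArg _ (one_smul ℝ _)
    _ = C * edist (φ x) (φ y) := by simp

theorem regularSpace_of_finiteDimensional (E : Type*) [NormedAddCommGroup E] [NormedSpace ℝ E]
    [FiniteDimensional ℝ E] (M : Type*) [TopologicalSpace M] [ChartedSpace E M] [T2Space M] :
    RegularSpace M := by
  have : LocallyCompactSpace M := ChartedSpace.locallyCompactSpace E M
  infer_instance

/-- Near a point, the distance in the chart is bounded by the Riemannian distance. -/
theorem exists_edist_extChartAt_le (z : M) : ∃ C : ℝ≥0, ∃ V ∈ 𝓝 z, ∀ x ∈ V, ∀ y ∈ V,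
    edist (extChartAt 𝓘(ℝ, E) z x) (extChartAt 𝓘(ℝ, E) z y)
      ≤ C * Manifold.riemannianEDist 𝓘(ℝ, E) x y := by
  have := regularSpace_of_finiteDimensional E M
  set φ := extChartAt 𝓘(ℝ, E) z with hφ
  obtain ⟨C, hC, h1⟩ := exists_norm_chartD_le (E := E) z
  lift C to ℝ≥0 using hC.le
  have hC0 : C ≠ 0 := by exact_mod_cast hC.ne'
  obtain ⟨u, u_mem, u_closed, hu⟩ := exists_mem_nhds_isClosed_subset
    (inter_mem h1 (extChartAt_source_mem_nhds (I := 𝓘(ℝ, E)) z))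
  obtain ⟨v, ⟨v_mem, v_open⟩, hv⟩ : ∃ v, (v ∈ 𝓝 z ∧ IsOpen v) ∧ v ⊆ u :=
    (nhds_basis_opens' z).mem_iff.1 u_mem
  obtain ⟨R, hR, hRv⟩ : ∃ R > 0, Metric.ball (φ z) R ⊆ φ.symm ⁻¹' v :=
    Metric.mem_nhds_iff.1 (extChartAt_preimage_mem_nhds v_mem)
  have hsource : ∀ y ∈ u, y ∈ (chartAt E z).source := fun y hy => by
    simpa [hφ] using (hu hy).2
  refine ⟨C, u ∩ φ ⁻¹' Metric.ball (φ z) (R / 4), inter_mem u_mem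
      ((continuousAt_extChartAt z).preimage_mem_nhds (Metric.ball_mem_nhds _ (by positivity))), ?_⟩
  intro x hx y hy
  have hxy : dist (φ x) (φ y) < R / 2 := by
    have h1 : dist (φ x) (φ z) < R / 4 := hx.2
    have h2 : dist (φ y) (φ z) < R / 4 := hy.2
    linarith [dist_triangle_right (φ x) (φ y) (φ z)]
  refine (ENNReal.div_le_iff' (by simp [hC0]) (by simp)).1 ?_
  refine le_of_forall_gt fun l hl => ?_
  rw [ENNReal.div_lt_iff (Or.inl (by simp [hC0])) (Or.inl (by simp)), mul_comm]
  -- A short path from `x` to `y` might leave the chart. If `C * l` is at least `R / 2`, then `dist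
  -- (φ x) (φ y) < R / 2` already suffices; otherwise the path is too short to escape.
  by_cases hlR : ENNReal.ofReal (R / 2) ≤ C * l
  · refine lt_of_lt_of_le ?_ hlR
    rw [edist_dist]
    exact (ENNReal.ofReal_lt_ofReal_iff (by positivity)).2 hxy
  push Not at hlR
  obtain ⟨γ, hγx, hγy, γ_smooth, hγ, -⟩ :=
    Manifold.exists_lt_locally_constant_of_riemannianEDist_lt hl zero_lt_one
  have hlen : ∀ t ∈ Icc (0 : ℝ) 1, Icc 0 t ⊆ γ ⁻¹' u → edist (φ (γ 0)) (φ (γ t)) < C * l := by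
    intro t ht htu
    have hd : ContDiffOn ℝ 1 (fun s => φ (γ s)) (Icc 0 t) := by
      rw [← contMDiffOn_iff_contDiffOn]
      exact contMDiffOn_extChartAt.comp (t := (chartAt E z).source) γ_smooth.contMDiffOn
        fun s hs => hsource _ (htu hs)
    have hlC : (C : ℝ≥0∞) * Manifold.pathELength 𝓘(ℝ, E) γ 0 1 < C * l :=
      (ENNReal.mul_lt_mul_iff_right (by simp [hC0]) (by simp)).2 hγ
    refine lt_of_le_of_lt ?_ hlC
    rcases ht.1.eq_or_lt with h0 | h0
    · simp [← h0]
    rw [edist_comm, edist_eq_enorm_sub]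
    calc _ ≤ ∫⁻ s in Icc 0 t, ‖derivWithin (fun s => φ (γ s)) (Icc 0 t) s‖ₑ :=
          enorm_sub_le_lintegral_derivWithin_Icc_of_contDiffOn_Icc hd ht.1
      _ ≤ ∫⁻ s in Icc 0 t, C * ‖mfderivWithin 𝓘(ℝ, ℝ) 𝓘(ℝ, E) γ (Icc 0 t) s 1‖ₑ := by
          refine setLIntegral_mono' measurableSet_Icc fun s hs => ?_
          have hγd := ((γ_smooth.mdifferentiable one_ne_zero) s).mdifferentiableWithinAt
            (s := Icc 0 t) |>.hasMFDerivWithinAt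
          set D := mfderivWithin 𝓘(ℝ, ℝ) 𝓘(ℝ, E) γ (Icc 0 t) s
          have hD : D = (1 : ℝ →L[ℝ] ℝ).smulRight (D 1) :=
            ContinuousLinearMap.ext_ring (one_smul ℝ (D 1)).symm
          rw [hD] at hγd
          have := hasDerivWithinAt_extChartAt_comp (z := z) hγd (hsource _ (htu hs))
          rw [this.derivWithin (uniqueDiffOn_Icc h0 s hs)]
          have h3 := (hu (htu hs)).1.1 (D 1)
          simp only [enorm, ← ENNReal.coe_mul, ENNReal.coe_le_coe, ← NNReal.coe_le_coe]
          exact h3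
      _ = C * Manifold.pathELength 𝓘(ℝ, E) γ 0 t := by
          rw [lintegral_const_mul' _ _ ENNReal.coe_ne_top,
            Manifold.pathELength_eq_lintegral_mfderivWithin_Icc]
      _ ≤ C * Manifold.pathELength 𝓘(ℝ, E) γ 0 1 := by
          exact mul_le_mul_right (Manifold.pathELength_mono le_rfl ht.2) _
  -- Continuous induction: while the path stays in `u`, its chart image is within `R / 2` of `φ x`,
  -- hence within `R` of `φ z`. It thus lies in the open set `v ⊆ u` and remains in `u` a little
  -- longer.
  have hall : Icc (0 : ℝ) 1 ⊆ γ ⁻¹' u := by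
    have hcl : IsClosed (γ ⁻¹' u ∩ Icc 0 1) :=
      (u_closed.preimage γ_smooth.continuous).inter isClosed_Icc
    refine hcl.Icc_subset_of_forall_mem_nhdsGT_of_Icc_subset (by simpa [hγx] using hx.1) ?_
    rintro t ⟨ht0, ht1⟩ htu
    have hlt := (hlen t ⟨ht0, ht1.le⟩ htu).trans hlR
    rw [edist_dist, ENNReal.ofReal_lt_ofReal_iff (by positivity), hγx] at hlt
    have hb : φ (γ t) ∈ Metric.ball (φ z) R := by
      have h2 : dist (φ x) (φ z) < R / 4 := hx.2
      rw [Metric.mem_ball]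
      linarith [dist_triangle_left (φ (γ t)) (φ z) (φ x)]
    have hmem : γ t ∈ v := by
      have := hRv hb
      rwa [mem_preimage, φ.left_inv (hu (htu ⟨ht0, le_rfl⟩)).2] at this
    exact mem_nhdsWithin_of_mem_nhds
      (γ_smooth.continuous.continuousAt.preimage_mem_nhds
        (mem_of_superset (v_open.mem_nhds hmem) hv))
  have := hlen 1 ⟨zero_le_one, le_rfl⟩ hall
  rwa [hγx, hγy] at this

/-- The points at finite distance from `x` form a clopen set, since every point has a neighbourhood
at finite distance from it. -/
theorem riemannianEDist_lt_top [ConnectedSpace M] (x y : M) :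
    Manifold.riemannianEDist 𝓘(ℝ, E) x y < ⊤ := by
  have hcl : IsClopen {y : M | Manifold.riemannianEDist 𝓘(ℝ, E) x y < ⊤} := by
    constructor
    · rw [← isOpen_compl_iff, isOpen_iff_mem_nhds]
      intro y hy
      filter_upwards [eventually_riemannianEDist_lt 𝓘(ℝ, E) y ENNReal.zero_lt_top] with w hw hc
      refine hy (lt_of_le_of_lt (Manifold.riemannianEDist_triangle (y := w)) (ENNReal.add_lt_top.2 ⟨hc, ?_⟩))
      rwa [Manifold.riemannianEDist_comm]
    · rw [isOpen_iff_mem_nhds]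
      intro y hy
      filter_upwards [eventually_riemannianEDist_lt 𝓘(ℝ, E) y ENNReal.zero_lt_top] with w hw
      exact lt_of_le_of_lt (Manifold.riemannianEDist_triangle (y := y)) (ENNReal.add_lt_top.2 ⟨hy, hw⟩)
  have huniv := hcl.eq_univ ⟨x, by simp [Manifold.riemannianEDist_self]⟩
  exact (huniv ▸ mem_univ y : y ∈ {y : M | Manifold.riemannianEDist 𝓘(ℝ, E) x y < ⊤})

theorem exists_riemannianEDist_le_of_isCompact [ConnectedSpace M] {L : Set M} (hL : IsCompact L) :
    ∃ D : ℝ≥0, ∀ x ∈ L, ∀ y ∈ L, Manifold.riemannianEDist 𝓘(ℝ, E) x y ≤ D := by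
  obtain ⟨x₀⟩ : Nonempty M := inferInstance
  obtain ⟨D, hD⟩ : ∃ D : ℝ≥0, ∀ y ∈ L, Manifold.riemannianEDist 𝓘(ℝ, E) x₀ y ≤ D := by
    refine hL.induction_on ⟨0, by simp⟩ (fun s t hst ⟨D, hD⟩ => ⟨D, fun y hy => hD y (hst hy)⟩)
      (fun s t ⟨D, hD⟩ ⟨D', hD'⟩ => ⟨max D D', ?_⟩) fun x _ => ?_
    · rintro y (hy | hy)
      · exact (hD y hy).trans (by simp)
      · exact (hD' y hy).trans (by simp)
    · have hx := riemannianEDist_lt_top (E := E) x₀ x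
      refine ⟨_, mem_nhdsWithin_of_mem_nhds
        (eventually_riemannianEDist_lt 𝓘(ℝ, E) x zero_lt_one),
        (Manifold.riemannianEDist 𝓘(ℝ, E) x₀ x).toNNReal + 1, fun y hy => ?_⟩
      refine (Manifold.riemannianEDist_triangle (y := x)).trans ?_
      push_cast
      rw [ENNReal.coe_toNNReal hx.ne]
      exact add_le_add le_rfl (le_of_lt hy)
  refine ⟨D + D, fun x hx y hy => (Manifold.riemannianEDist_triangle (y := x₀)).trans ?_⟩
  push_cast
  refine add_le_add ?_ (hD y hy)
  rw [Manifold.riemannianEDist_comm]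
  exact hD x hx

end Distance

/-! ### Integral curves -/

section Curves

/-- Absolutely continuous functions can be glued. -/
theorem absolutelyContinuousOnInterval_trans {h : ℝ → ℝ} {a b c : ℝ}
    (hab : AbsolutelyContinuousOnInterval h a b) (hbc : AbsolutelyContinuousOnInterval h b c) :
    AbsolutelyContinuousOnInterval h a c := by
  have hi : IntervalIntegrable (deriv h) volume a c :=
    hab.intervalIntegrable_deriv.trans hbc.intervalIntegrable_deriv
  have hsub : ∀ {a b : ℝ}, AbsolutelyContinuousOnInterval h a b → ∀ s ∈ uIcc a b,
      ∀ t ∈ uIcc a b, ∫ r in s..t, deriv h r = h t - h s := fun hab s hs t ht =>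
    (hab.mono (uIcc_subset_uIcc hs ht)).integral_deriv_eq_sub
  -- Being the primitive of an integrable derivative is a property that glues, and it implies
  -- absolute continuity.
  have key : ∀ t ∈ uIcc a c, h t = h a + ∫ s in a..t, deriv h s := by
    intro t ht
    rcases uIcc_subset_uIcc_union_uIcc (b := b) ht with ht | ht
    · rw [hsub hab a left_mem_uIcc t ht]; ring
    · have h1 := hsub hab a left_mem_uIcc b right_mem_uIcc
      have h2 := hsub hbc b left_mem_uIcc t ht
      rw [← intervalIntegral.integral_add_adjacent_intervals hab.intervalIntegrable_deriv
        (hbc.mono (uIcc_subset_uIcc left_mem_uIcc ht)).intervalIntegrable_deriv, h1, h2]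
      ring
  refine absolutelyContinuousOnInterval_of_dist_le (C := 1)
    (hi.absolutelyContinuousOnInterval_intervalIntegral left_mem_uIcc) fun s hs t ht => ?_
  rw [key s hs, key t ht, dist_add_left, one_mul]

theorem AbsolutelyContinuousOnInterval.congr {h k : ℝ → ℝ} {a b : ℝ}
    (hh : AbsolutelyContinuousOnInterval h a b) (hk : EqOn h k (uIcc a b)) :
    AbsolutelyContinuousOnInterval k a b :=
  absolutelyContinuousOnInterval_of_dist_le (C := 1) hh fun s hs t ht => by
    rw [hk hs, hk ht, one_mul]

theorem ae_ne (c : ℝ) : ∀ᵐ t : ℝ, t ≠ c := by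
  simp [ae_iff, measure_singleton]

theorem uIcc_mem_nhds_of_ne {a b t : ℝ} (ht : t ∈ uIcc a b) (ha : t ≠ a) (hb : t ≠ b) :
    uIcc a b ∈ 𝓝 t := by
  rcases le_total a b with h | h
  · rw [uIcc_of_le h] at ht ⊢
    exact Icc_mem_nhds (lt_of_le_of_ne ht.1 ha.symm) (lt_of_le_of_ne ht.2 hb)
  · rw [uIcc_of_ge h] at ht ⊢
    exact Icc_mem_nhds (lt_of_le_of_ne ht.1 hb.symm) (lt_of_le_of_ne ht.2 ha)

variable {E : Type*} [NormedAddCommGroup E] [NormedSpace ℝ E]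
  {M : Type*} [TopologicalSpace M] [ChartedSpace E M]

/-- Supports of smooth bump functions form a neighbourhood basis. The composition of such a function
with `γ` is continuous and nonzero at `t`, so `γ` stays in the support nearby. -/
theorem LocACOn.continuousOn [FiniteDimensional ℝ E] [T2Space M] [IsManifold 𝓘(ℝ, E) ∞ M]
    {γ : ℝ → M} {J : Set ℝ} (h : LocACOn (E := E) γ J)
    {a b : ℝ} (ha : a ∈ J) (hb : b ∈ J) : ContinuousOn γ (uIcc a b) := by
  intro t ht
  refine (SmoothBumpFunction.nhds_basis_support (I := 𝓘(ℝ, E)) univ_mem).tendsto_right_iff.2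
    fun f _ => ?_
  have h1 := (h f f.contMDiff a ha b hb).continuousOn t ht
  have h2 : (f ∘ γ) t ≠ 0 := by simp
  exact h1.eventually_ne h2

variable {T : Set ℝ} {X : ℝ → (x : M) → TangentSpace 𝓘(ℝ, E) x}

theorem IsIntCurve.mono {γ : ℝ → M} {J J' : Set ℝ} (h : IsIntCurve T X γ J) (hJ : J' ⊆ J)
    (ho : J'.OrdConnected) : IsIntCurve T X γ J' where
  ordConnected := ho
  subset := hJ.trans h.subset
  locAC f hf a ha b hb := h.locAC f hf a (hJ ha) b (hJ hb)
  deriv := h.deriv.mono fun _ ht htJ => (ht (hJ htJ)).mono hJ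

theorem Reaches.exists_isIntCurve_uIcc {τ a : ℝ} {x y : M} (h : Reaches T X τ a x y) :
    ∃ γ : ℝ → M, IsIntCurve T X γ (uIcc a τ) ∧ γ a = x ∧ γ τ = y := by
  obtain ⟨J, γ, hγ, ha, hx, hτ, hy⟩ := h
  exact ⟨γ, hγ.mono (hγ.ordConnected.uIcc_subset ha hτ) ordConnected_uIcc, hx, hy⟩

theorem Reaches.exists_between {τ a b : ℝ} {x y : M} (h : Reaches T X τ a x y)
    (hb : b ∈ uIcc a τ) : ∃ z, Reaches T X b a x z ∧ Reaches T X τ b z y := by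
  obtain ⟨γ, hγ, hx, hy⟩ := h.exists_isIntCurve_uIcc
  exact ⟨γ b, ⟨_, γ, hγ, left_mem_uIcc, hx, hb, rfl⟩, ⟨_, γ, hγ, hb, rfl, right_mem_uIcc, hy⟩⟩

theorem Reaches.trans {τ a b : ℝ} {x y z : M} (h₁ : Reaches T X b a x z)
    (h₂ : Reaches T X τ b z y) (hb : b ∈ uIcc a τ) : Reaches T X τ a x y := by
  classical
  obtain ⟨γ₁, hγ₁, hx, hz⟩ := h₁.exists_isIntCurve_uIcc
  obtain ⟨γ₂, hγ₂, hz', hy⟩ := h₂.exists_isIntCurve_uIcc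
  let γ : ℝ → M := (uIcc a b).piecewise γ₁ γ₂
  have e₁ : EqOn γ γ₁ (uIcc a b) := fun t ht => piecewise_eq_of_mem _ _ _ ht
  -- As `b` lies between `a` and `τ`, the two time intervals meet only at `b`, where the curves
  -- agree.
  have hinter : ∀ t ∈ uIcc a b, t ∈ uIcc b τ → t = b := by
    intro t h1 h2
    rcases le_total a τ with h | h
    · rw [uIcc_of_le h] at hb
      rw [uIcc_of_le hb.1] at h1
      rw [uIcc_of_le hb.2] at h2
      exact le_antisymm h1.2 h2.1
    · rw [uIcc_of_ge h] at hb
      rw [uIcc_of_ge hb.2] at h1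
      rw [uIcc_of_ge hb.1] at h2
      exact le_antisymm h2.2 h1.1
  have e₂ : EqOn γ γ₂ (uIcc b τ) := by
    intro t ht
    by_cases h : t ∈ uIcc a b
    · rw [hinter t h ht, e₁ right_mem_uIcc, hz, hz']
    · exact piecewise_eq_of_notMem _ _ _ h
  have hunion : uIcc a τ ⊆ uIcc a b ∪ uIcc b τ := uIcc_subset_uIcc_union_uIcc
  refine ⟨uIcc a τ, γ, ⟨ordConnected_uIcc, ?_, ?_, ?_⟩, left_mem_uIcc, ?_, right_mem_uIcc, ?_⟩
  · exact hunion.trans (union_subset hγ₁.subset hγ₂.subset)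
  · intro f hf s hs t ht
    refine AbsolutelyContinuousOnInterval.mono ?_ (uIcc_subset_uIcc hs ht)
    refine absolutelyContinuousOnInterval_trans (b := b) ?_ ?_
    · exact AbsolutelyContinuousOnInterval.congr
        (hγ₁.locAC f hf a left_mem_uIcc b right_mem_uIcc) fun t ht => by simp [e₁ ht]
    · exact AbsolutelyContinuousOnInterval.congr
        (hγ₂.locAC f hf b left_mem_uIcc τ right_mem_uIcc) fun t ht => by simp [e₂ ht]
  · have key : ∀ {γ' : ℝ → M} {c d t : ℝ}, EqOn γ γ' (uIcc c d) → t ∈ uIcc c d → t ≠ c → t ≠ d →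
        HasMFDerivWithinAt 𝓘(ℝ, ℝ) 𝓘(ℝ, E) γ' (uIcc c d) t
          ((1 : ℝ →L[ℝ] ℝ).smulRight (X t (γ' t))) →
        HasMFDerivWithinAt 𝓘(ℝ, ℝ) 𝓘(ℝ, E) γ (uIcc a τ) t
          ((1 : ℝ →L[ℝ] ℝ).smulRight (X t (γ t))) := by
      intro γ' c d t he ht h1 h2 hd
      have hn := uIcc_mem_nhds_of_ne ht h1 h2
      rw [he ht]
      exact ((hd.hasMFDerivAt hn).congr_of_eventuallyEq
        (he.eventuallyEq_of_mem hn)).hasMFDerivWithinAt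
    -- Away from the three endpoints each piece is defined on a neighbourhood of `t`, so one-sided
    -- derivatives never have to be matched.
    filter_upwards [hγ₁.deriv, hγ₂.deriv, ae_ne a, ae_ne b, ae_ne τ] with t h1 h2 ha hb hτ ht
    rcases hunion ht with ht | ht
    · exact key e₁ ht ha hb (h1 ht)
    · exact key e₂ ht hb hτ (h2 ht)
  · rw [e₁ left_mem_uIcc, hx]
  · rw [e₂ right_mem_uIcc, hy]

variable [IsManifold 𝓘(ℝ, E) ∞ M] [FiniteDimensional ℝ E] [T2Space M]

/-- An integral curve which stays in a chart ball satisfies the integral equation in the chart. -/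
theorem IsIntCurve.extChartAt_comp_eq {γ : ℝ → M} {z : M} {r R a b : ℝ}
    (h : IsIntCurve T X γ (uIcc a b)) (hr : 0 < r) (hrR : r < R)
    (hR : Metric.closedBall (extChartAt 𝓘(ℝ, E) z z) R ⊆ (extChartAt 𝓘(ℝ, E) z).target)
    (hγ : ∀ t ∈ uIcc a b, γ t ∈ (chartAt E z).source ∧
      extChartAt 𝓘(ℝ, E) z (γ t) ∈ Metric.closedBall (extChartAt 𝓘(ℝ, E) z z) r)
    (hint : IntegrableOn (fun t => chartRep z (X t) (extChartAt 𝓘(ℝ, E) z (γ t))) (uIcc a b)) :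
    ∀ t ∈ uIcc a b, extChartAt 𝓘(ℝ, E) z (γ t) = extChartAt 𝓘(ℝ, E) z (γ a) +
      ∫ s in a..t, chartRep z (X s) (extChartAt 𝓘(ℝ, E) z (γ s)) := by
  intro t ht
  have hsub : uIcc a t ⊆ uIcc a b := uIcc_subset_uIcc left_mem_uIcc ht
  rw [integral_eq_sub_of_forall_dual (h := fun s => extChartAt 𝓘(ℝ, E) z (γ s)), add_sub_cancel]
  · intro l
    -- Absolute continuity can only be tested against functions smooth on all of `M`. The bump
    -- function is `1` on the ball of radius `r`, where the curve lives, and the larger radius `R`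
    -- leaves room for the cut-off inside the chart.
    let f : SmoothBumpFunction 𝓘(ℝ, E) z :=
      ⟨⟨r, R, hr, hrR⟩, fun e he => hR he.1⟩
    have hF : ContMDiff 𝓘(ℝ, E) 𝓘(ℝ, ℝ) ∞ fun x => f x • l (extChartAt 𝓘(ℝ, E) z x) :=
      f.contMDiff_smul (l.contDiff.contMDiff.comp_contMDiffOn contMDiffOn_extChartAt)
    refine AbsolutelyContinuousOnInterval.congr (h.locAC _ hF a left_mem_uIcc t ht) fun s hs => ?_
    have h1 : f (γ s) = 1 := f.one_of_dist_le (hγ s (hsub hs)).1 (hγ s (hsub hs)).2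
    simp [h1]
  · filter_upwards [h.deriv, ae_ne a, ae_ne t] with s hs ha hst hsm
    have hsm' := uIoc_subset_uIcc hsm
    have h1 := hasDerivWithinAt_extChartAt_comp (z := z) (hs (hsub hsm')) (hγ s (hsub hsm')).1
    have h2 := (h1.mono hsub).hasDerivAt (uIcc_mem_nhds_of_ne hsm' ha hst)
    refine h2.congr_deriv ?_
    unfold chartRep localRep
    rw [(extChartAt 𝓘(ℝ, E) z).left_inv (by simpa using (hγ s (hsub hsm')).1)]
  · exact intervalIntegrable_of_integrableOn_uIcc hint left_mem_uIcc ht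

/-- A solution of the integral equation in a chart gives an integral curve. -/
theorem isIntCurve_of_integral_eq {u : ℝ → E} {z : M} {r a b : ℝ} (hT : uIcc a b ⊆ T)
    (hr : Metric.closedBall (extChartAt 𝓘(ℝ, E) z z) r ⊆ (extChartAt 𝓘(ℝ, E) z).target)
    (huB : ∀ t ∈ uIcc a b, u t ∈ Metric.closedBall (extChartAt 𝓘(ℝ, E) z z) r)
    (hint : IntegrableOn (fun t => chartRep z (X t) (u t)) (uIcc a b)) {x : E}
    (hu : ∀ t ∈ uIcc a b, u t = x + ∫ s in a..t, chartRep z (X s) (u s)) :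
    IsIntCurve T X (fun t => (extChartAt 𝓘(ℝ, E) z).symm (u t)) (uIcc a b) := by
  set φ := extChartAt 𝓘(ℝ, E) z with hφ
  set g := fun t => chartRep z (X t) (u t) with hg
  have hi : ∀ s ∈ uIcc a b, ∀ t ∈ uIcc a b, IntervalIntegrable g volume s t := fun s hs t ht =>
    intervalIntegrable_of_integrableOn_uIcc hint hs ht
  refine ⟨ordConnected_uIcc, hT, ?_, ?_⟩
  · intro f hf s hs t ht
    refine AbsolutelyContinuousOnInterval.mono ?_ (uIcc_subset_uIcc hs ht)
    obtain ⟨K, hK⟩ : ∃ K : ℝ≥0, LipschitzOnWith K (f ∘ φ.symm) (Metric.closedBall (φ z) r) := by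
      refine LocallyLipschitzOn.exists_lipschitzOnWith_of_compact (isCompact_closedBall _ _) ?_
      intro e he
      have h1 : ContMDiffAt 𝓘(ℝ, E) 𝓘(ℝ, ℝ) ∞ (f ∘ φ.symm) e :=
        hf.contMDiffAt.comp e ((contMDiffOn_extChartAt_symm (n := ∞) (I := 𝓘(ℝ, E)) z).contMDiffAt
          ((isOpen_extChartAt_target z).mem_nhds (hr he)))
      obtain ⟨K, U, hU, h⟩ := (h1.contDiffAt.of_le (m := 1) (by simp)).exists_lipschitzOnWith
      exact ⟨K, U, mem_nhdsWithin_of_mem_nhds hU, h⟩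
    -- The increments of `u` are dominated by those of the absolutely continuous primitive of `‖g‖`,
    -- and `f ∘ φ.symm` is Lipschitz on the ball.
    refine absolutelyContinuousOnInterval_of_dist_le (C := K)
      (IntervalIntegrable.absolutelyContinuousOnInterval_intervalIntegral (c := a)
        (hi a left_mem_uIcc b right_mem_uIcc).norm left_mem_uIcc) fun s hs t ht => ?_
    refine (hK.dist_le_mul _ (huB s hs) _ (huB t ht)).trans ?_
    gcongr
    rw [dist_comm, dist_comm (∫ v in a..s, ‖g v‖), dist_eq_norm, Real.dist_eq,
      intervalIntegral.integral_interval_sub_left (hi a left_mem_uIcc t ht).norm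
        (hi a left_mem_uIcc s hs).norm, hu s hs, hu t ht, add_sub_add_left_eq_sub,
      intervalIntegral.integral_interval_sub_left (hi a left_mem_uIcc t ht)
        (hi a left_mem_uIcc s hs)]
    exact intervalIntegral.norm_integral_le_abs_integral_norm
  · filter_upwards [(hi a left_mem_uIcc b right_mem_uIcc).ae_hasDerivAt_integral] with t h1 ht
    have h2 := ((h1 ht a left_mem_uIcc).const_add x).hasDerivWithinAt (s := uIcc a b)
    have h3 : HasDerivWithinAt u (g t) (uIcc a b) t := h2.congr hu (hu t ht)
    have h4 := hasMFDerivWithinAt_extChartAt_symm_comp h3 (hr (huB t ht))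
    have hy : φ.symm (u t) ∈ (chartAt E z).source := by
      simpa [hφ] using φ.map_target (hr (huB t ht))
    have h5 : chartDSymm z (φ.symm (u t)) (g t) = X t (φ.symm (u t)) := chartDSymm_chartD hy _
    rwa [h5] at h4

end Curves

/-! ### The local flow in a chart -/

section LocalFlow

variable {E : Type*} [NormedAddCommGroup E] [NormedSpace ℝ E] [FiniteDimensional ℝ E]
  {M : Type*} [TopologicalSpace M] [ChartedSpace E M] [IsManifold 𝓘(ℝ, E) ∞ M] [T2Space M]

theorem setIntegral_mono_of_isCaratheodoryOn {f : ℝ → E → E} {m : ℝ → ℝ} {B : Set E}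
    {I J : Set ℝ} (hf : IsCaratheodoryOn f m B I) (h : J ⊆ I) :
    ∫ t in J, m t ≤ ∫ t in I, m t :=
  setIntegral_mono_set hf.integrable (hf.bound.mono fun _ ht => ht.1) h.eventuallyLE

theorem neBot_nhdsWithin_uIcc_diff {a s : ℝ} (h : s ≠ a) :
    (𝓝[uIcc a s \ {s}] s).NeBot := by
  rcases lt_or_gt_of_ne h with h | h
  · have := left_nhdsWithin_Ioc_neBot h
    refine this.mono (nhdsWithin_mono _ fun t ht => ?_)
    rw [uIcc_of_ge h.le]
    exact ⟨Ioc_subset_Icc_self ht, ht.1.ne'⟩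
  · have := right_nhdsWithin_Ico_neBot h
    refine this.mono (nhdsWithin_mono _ fun t ht => ?_)
    rw [uIcc_of_le h.le]
    exact ⟨Ico_subset_Icc_self ht, ht.2.ne⟩

theorem abs_sub_lt_of_mem_uIcc {a s t : ℝ} (ht : t ∈ uIcc a s) (hts : t ≠ s) :
    |t - a| < |s - a| := by
  rcases le_total a s with h | h
  · rw [uIcc_of_le h] at ht
    rw [abs_of_nonneg (by linarith [ht.1]), abs_of_nonneg (by linarith)]
    linarith [lt_of_le_of_ne ht.2 hts]
  · rw [uIcc_of_ge h] at ht
    rw [abs_of_nonpos (by linarith [ht.2]), abs_of_nonpos (by linarith)]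
    linarith [lt_of_le_of_ne ht.1 hts.symm]

variable {T : Set ℝ} {X : ℝ → (x : M) → TangentSpace 𝓘(ℝ, E) x}

/-- Existence and uniqueness of integral curves in a chart ball, over a short time interval. -/
theorem exists_solution_reaches_iff {z : M} {m : ℝ → ℝ} {r R a b : ℝ} (hT : uIcc a b ⊆ T)
    (hr : 0 < r) (hrR : r < R)
    (hR : Metric.closedBall (extChartAt 𝓘(ℝ, E) z z) R ⊆ (extChartAt 𝓘(ℝ, E) z).target)
    (hcar : IsCaratheodoryOn (fun t => chartRep z (X t)) m
      (Metric.closedBall (extChartAt 𝓘(ℝ, E) z z) r) (uIcc a b))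
    (hm : ∫ t in uIcc a b, m t ≤ 1 / 2) (hmr : ∫ t in uIcc a b, m t ≤ r / 4) {x : M}
    (hxs : x ∈ (chartAt E z).source)
    (hx : extChartAt 𝓘(ℝ, E) z x ∈ Metric.closedBall (extChartAt 𝓘(ℝ, E) z z) (r / 2)) :
    ∃ u : ℝ → E, ContinuousOn u (uIcc a b) ∧
      (∀ t ∈ uIcc a b, u t ∈ Metric.closedBall (extChartAt 𝓘(ℝ, E) z z) r) ∧
      u a = extChartAt 𝓘(ℝ, E) z x ∧
      (∀ t ∈ uIcc a b, u t = u a + ∫ s in a..t, chartRep z (X s) (u s)) ∧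
      ∀ τ ∈ uIcc a b, ∀ y, Reaches T X τ a x y ↔ y = (extChartAt 𝓘(ℝ, E) z).symm (u τ) := by
  set φ := extChartAt 𝓘(ℝ, E) z with hφ
  have hsrc : ∀ {y : M}, y ∈ (chartAt E z).source ↔ y ∈ φ.source := by simp [hφ]
  obtain ⟨u, huc, huB, hu⟩ := hcar.exists_solution hm (by linarith) hx
  have hua : u a = φ x := by simpa using hu a left_mem_uIcc
  have hrt : Metric.closedBall (φ z) r ⊆ φ.target :=
    (Metric.closedBall_subset_closedBall hrR.le).trans hR
  have hint := hcar.integrableOn_comp huc huB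
  have hcurve := isIntCurve_of_integral_eq (T := T) (X := X) hT hrt huB hint hu
  -- The bound `r / 2 + r / 4 < r` keeps the solution strictly inside the ball, which the exit
  -- argument below needs.
  have hub : ∀ t ∈ uIcc a b, u t ∈ Metric.ball (φ z) r := by
    intro t ht
    have h1 : ‖∫ s in a..t, chartRep z (X s) (u s)‖ ≤ r / 4 := by
      refine (norm_intervalIntegral_le_setIntegral left_mem_uIcc ht hcar.integrable ?_).trans hmr
      filter_upwards [hcar.bound, ae_restrict_mem measurableSet_uIcc] with s hs hsm
      exact hs.2.1 _ (huB s hsm)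
    have h2 : dist (u t) (φ x) ≤ r / 4 := by
      rw [dist_eq_norm, hu t ht, add_sub_cancel_left]
      exact h1
    have h3 : dist (φ x) (φ z) ≤ r / 2 := hx
    rw [Metric.mem_ball]
    linarith [dist_triangle (u t) (φ x) (φ z)]
  refine ⟨u, huc, huB, hua, fun t ht => hua ▸ hu t ht, fun τ hτ y => ⟨fun h => ?_, ?_⟩⟩
  swap
  · rintro rfl
    refine ⟨_, _, hcurve, left_mem_uIcc, ?_, hτ, rfl⟩
    rw [hua, φ.left_inv (hsrc.1 hxs)]
  obtain ⟨γ, hγ, hγx, rfl⟩ := h.exists_isIntCurve_uIcc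
  have hsub : uIcc a τ ⊆ uIcc a b := uIcc_subset_uIcc left_mem_uIcc hτ
  have hγc : ContinuousOn γ (uIcc a τ) := hγ.locAC.continuousOn left_mem_uIcc right_mem_uIcc
  let V : Set M := (chartAt E z).source ∩ φ ⁻¹' Metric.ball (φ z) r
  have hV : IsOpen V := isOpen_extChartAt_preimage z Metric.isOpen_ball
  -- As long as the curve stays in `V`, stability with equal right-hand sides and equal initial
  -- values is uniqueness.
  have huniq : ∀ s ∈ uIcc a τ, (∀ t ∈ uIcc a s, γ t ∈ V) → γ s = φ.symm (u s) := by
    intro s hs hsV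
    have hsτ : uIcc a s ⊆ uIcc a τ := uIcc_subset_uIcc left_mem_uIcc hs
    have hcar' := hcar.mono (hsτ.trans hsub)
    have hwc : ContinuousOn (fun t => φ (γ t)) (uIcc a s) :=
      (continuousOn_extChartAt z).comp (hγc.mono hsτ) fun t ht => hsrc.1 (hsV t ht).1
    have hwB : ∀ t ∈ uIcc a s, φ (γ t) ∈ Metric.closedBall (φ z) r := fun t ht =>
      Metric.ball_subset_closedBall (hsV t ht).2
    have hw := (hγ.mono hsτ ordConnected_uIcc).extChartAt_comp_eq hr hrR hR
      (fun t ht => ⟨(hsV t ht).1, hwB t ht⟩) (hcar'.integrableOn_comp hwc hwB)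
    have h1 := norm_sub_le_of_integral_eq (n := 0) hcar' hcar'
      ((setIntegral_mono_of_isCaratheodoryOn hcar (hsτ.trans hsub)).trans hm)
      integrableOn_zero (ae_of_all _ fun t e _ => by simp)
      hwc (huc.mono (hsτ.trans hsub)) hwB (fun t ht => huB t (hsub (hsτ ht))) hw
      (fun t ht => hua ▸ hu t (hsub (hsτ ht))) s right_mem_uIcc
    have h2 : φ (γ s) = u s := by
      rw [hγx, hua] at h1
      simpa [sub_eq_zero] using h1
    rw [← h2, φ.left_inv (hsrc.1 (hsV s right_mem_uIcc).1)]
  refine huniq τ right_mem_uIcc ?_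
  -- First exit: `s` is the time outside `V` closest to `a`, measured by `|t - a|` because `a` may
  -- be either end. Before `s` the curve coincides with the chart solution, hence also at `s` by
  -- continuity; but that solution is in the open ball at time `s`.
  by_contra! hcon
  have hcl : IsCompact (uIcc a τ ∩ γ ⁻¹' Vᶜ) :=
    isCompact_uIcc.of_isClosed_subset
      (hγc.preimage_isClosed_of_isClosed isCompact_uIcc.isClosed hV.isClosed_compl)
      inter_subset_left
  obtain ⟨s, hs, hmin⟩ := hcl.exists_isMinOn (f := fun t => |t - a|) hcon
    (by fun_prop)
  have hlt : ∀ t ∈ uIcc a s, t ≠ s → γ t ∈ V := by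
    intro t ht hts
    by_contra htV
    have h1 : |s - a| ≤ |t - a| := hmin ⟨uIcc_subset_uIcc left_mem_uIcc hs.1 ht, htV⟩
    exact absurd (abs_sub_lt_of_mem_uIcc ht hts) h1.not_gt
  have hsa : s ≠ a := by
    rintro rfl
    refine hs.2 ⟨hγx ▸ hxs, ?_⟩
    rw [mem_preimage, hγx]
    exact Metric.closedBall_subset_ball (by linarith) hx
  have hss : uIcc a s ⊆ uIcc a τ := uIcc_subset_uIcc left_mem_uIcc hs.1
  have heq : ∀ t ∈ uIcc a s \ {s}, φ.symm (u t) = γ t := by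
    intro t ht
    refine (huniq t (hss ht.1) fun t' ht' => hlt t' ?_ ?_).symm
    · exact uIcc_subset_uIcc left_mem_uIcc ht.1 ht'
    · rintro rfl
      by_cases h : t' = t
      · exact ht.2 h.symm
      · exact absurd (abs_sub_lt_of_mem_uIcc ht.1 ht.2) (abs_sub_lt_of_mem_uIcc ht' h).not_gt
  have := neBot_nhdsWithin_uIcc_diff hsa
  have hl1 : Tendsto γ (𝓝[uIcc a s \ {s}] s) (𝓝 (γ s)) :=
    (hγc s hs.1).mono (sdiff_subset.trans hss)
  have hl2 : Tendsto (fun t => φ.symm (u t)) (𝓝[uIcc a s \ {s}] s) (𝓝 (φ.symm (u s))) :=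
    (((continuousOn_extChartAt_symm z).continuousAt
      ((isOpen_extChartAt_target z).mem_nhds (hrt (huB s (hsub hs.1))))).comp_continuousWithinAt
      (huc s (hsub hs.1))).mono (sdiff_subset.trans (hss.trans hsub))
  have hγs : γ s = φ.symm (u s) :=
    tendsto_nhds_unique hl1 (hl2.congr' (eventually_mem_nhdsWithin.mono heq))
  refine hs.2 ⟨?_, ?_⟩
  · rw [hγs]
    exact hsrc.2 (φ.map_target (hrt (huB s (hsub hs.1))))
  · rw [mem_preimage, hγs, φ.right_inv (hrt (huB s (hsub hs.1)))]
    exact hub s (hsub hs.1)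

variable [RiemannianBundle (fun x : M => TangentSpace 𝓘(ℝ, E) x)]
  {nabla : CovariantDerivative 𝓘(ℝ, E) E (fun x : M => TangentSpace 𝓘(ℝ, E) x)}

theorem IsLipLI.aestronglyMeasurable_chartRep (hX : IsLipLI nabla T X) {I : Set ℝ} (hI : I ⊆ T)
    (z : M) (u : E) :
    AEStronglyMeasurable (fun t => chartRep z (X t) u) (volume.restrict I) :=
  ((chartD z ((extChartAt 𝓘(ℝ, E) z).symm u)).continuous.comp_aestronglyMeasurable
    (hX.measurable _)).mono_measure (Measure.restrict_mono_set _ hI)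

/-- A time-dependent vector field with integrable `p_K^lip` has a Carathéodory representative. -/
theorem isCaratheodoryOn_chartRep {z : M} {C r : ℝ} {K : Set M} {I : Set ℝ} (hC : 0 ≤ C)
    (hest : ∀ ξ : (x : M) → TangentSpace 𝓘(ℝ, E) x, IsLipSection ξ → pLip nabla K ξ ≠ ⊤ →
      (∀ u ∈ Metric.closedBall (extChartAt 𝓘(ℝ, E) z z) r,
        ‖chartRep z ξ u‖ ≤ C * (pLip nabla K ξ).toReal) ∧
      ∀ u ∈ Metric.closedBall (extChartAt 𝓘(ℝ, E) z z) r,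
        ∀ v ∈ Metric.closedBall (extChartAt 𝓘(ℝ, E) z z) r,
        ‖chartRep z ξ u - chartRep z ξ v‖ ≤ C * (pLip nabla K ξ).toReal * ‖u - v‖)
    (hI : MeasurableSet I) (hlip : ∀ t ∈ I, IsLipSection (X t))
    (hmeas : ∀ u, AEStronglyMeasurable (fun t => chartRep z (X t) u) (volume.restrict I))
    (hae : AEMeasurable (fun t => pLip nabla K (X t)) (volume.restrict I))
    (hfin : ∫⁻ t in I, pLip nabla K (X t) ≠ ⊤) :
    IsCaratheodoryOn (fun t => chartRep z (X t)) (fun t => C * (pLip nabla K (X t)).toReal)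
        (Metric.closedBall (extChartAt 𝓘(ℝ, E) z z) r) I ∧
      ∫ t in I, C * (pLip nabla K (X t)).toReal =
        C * (∫⁻ t in I, pLip nabla K (X t)).toReal := by
  have htop := ae_lt_top' hae hfin
  refine ⟨⟨fun u _ => hmeas u, (integrable_toReal_of_lintegral_ne_top hae hfin).const_mul C, ?_⟩, ?_⟩
  · filter_upwards [htop, ae_restrict_mem hI] with t ht htI
    have := hest (X t) (hlip t htI) ht.ne
    exact ⟨by positivity, this.1, this.2⟩
  · rw [integral_const_mul, integral_toReal hae htop]

theorem IsCaratheodoryOn.add {f g : ℝ → E → E} {m n : ℝ → ℝ} {B : Set E} {I : Set ℝ}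
    (hf : IsCaratheodoryOn f m B I) (hg : IsCaratheodoryOn g n B I) :
    IsCaratheodoryOn (fun t x => f t x + g t x) (fun t => m t + n t) B I where
  measurable x hx := (hf.measurable x hx).add (hg.measurable x hx)
  integrable := hf.integrable.add hg.integrable
  bound := by
    filter_upwards [hf.bound, hg.bound] with t h1 h2
    refine ⟨add_nonneg h1.1 h2.1,
      fun x hx => (norm_add_le _ _).trans (add_le_add (h1.2.1 x hx) (h2.2.1 x hx)),
      fun x hx y hy => ?_⟩
    rw [add_sub_add_comm, add_mul]
    exact (norm_add_le _ _).trans (add_le_add (h1.2.2 x hx y hy) (h2.2.2 x hx y hy))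

end LocalFlow

/-! ### Uniform Lipschitz estimates along an integral curve -/

section FlowStep

variable {E : Type*} [NormedAddCommGroup E] [NormedSpace ℝ E]
  {M : Type*} [TopologicalSpace M] [ChartedSpace E M] [IsManifold 𝓘(ℝ, E) ∞ M]
  [RiemannianBundle (fun x : M => TangentSpace 𝓘(ℝ, E) x)]
  {P : Type*} [TopologicalSpace P]

/-- From time `a` to time `b`, the integral curves starting near `x₀` for parameters near `p₀`
exist, depend in a Lipschitz way on the initial value, stay in a compact set, and end up
near `y₀`. -/
def HasLipschitzFlow (T : Set ℝ) (X : P → ℝ → (x : M) → TangentSpace 𝓘(ℝ, E) x) (p₀ : P)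
    (a b : ℝ) (x₀ y₀ : M) : Prop :=
  ∀ W ∈ 𝓝 y₀, ∃ C : ℝ≥0, ∃ U ∈ 𝓝 x₀, ∃ O ∈ 𝓝 p₀, ∃ L : Set M, IsCompact L ∧
    ∀ p ∈ O, ∀ τ ∈ uIcc a b, (∀ x ∈ U, ∃ y, Reaches T (X p) τ a x y) ∧
      (∀ x ∈ U, ∀ y, Reaches T (X p) τ a x y → y ∈ L ∧ (τ = b → y ∈ W)) ∧
      ∀ x₁ ∈ U, ∀ x₂ ∈ U, ∀ y₁ y₂, Reaches T (X p) τ a x₁ y₁ → Reaches T (X p) τ a x₂ y₂ →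
        Manifold.riemannianEDist 𝓘(ℝ, E) y₁ y₂ ≤ C * Manifold.riemannianEDist 𝓘(ℝ, E) x₁ x₂

variable {T : Set ℝ} {X : P → ℝ → (x : M) → TangentSpace 𝓘(ℝ, E) x} {p₀ : P}

/-- The target neighbourhood in `HasLipschitzFlow` is arbitrary, so the first flow can be made to
end inside the domain of the second. -/
theorem HasLipschitzFlow.trans {a b c : ℝ} {x₀ y₀ z₀ : M}
    (h₁ : HasLipschitzFlow T X p₀ a b x₀ y₀) (h₂ : HasLipschitzFlow T X p₀ b c y₀ z₀)
    (hb : b ∈ uIcc a c) : HasLipschitzFlow T X p₀ a c x₀ z₀ := by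
  intro W hW
  obtain ⟨C₂, U₂, hU₂, O₂, hO₂, L₂, hL₂, H₂⟩ := h₂ W hW
  obtain ⟨C₁, U₁, hU₁, O₁, hO₁, L₁, hL₁, H₁⟩ := h₁ U₂ hU₂
  -- Times on the first leg need `C₁`, times on the second need `C₂ * C₁`; the sum covers both.
  refine ⟨C₁ + C₂ * C₁, U₁, hU₁, O₁ ∩ O₂, inter_mem hO₁ hO₂, L₁ ∪ L₂, hL₁.union hL₂, ?_⟩
  rintro p ⟨hp₁, hp₂⟩ τ hτ
  have hC : ∀ d : ℝ≥0∞, ((C₁ + C₂ * C₁ : ℝ≥0) : ℝ≥0∞) * d = C₁ * d + C₂ * (C₁ * d) := fun d => by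
    push_cast
    rw [add_mul, mul_assoc]
  by_cases hτb : τ ∈ uIcc b c
  · have hbτ : b ∈ uIcc a τ := by
      rcases le_total a c with h | h
      · rw [uIcc_of_le h] at hb
        rw [uIcc_of_le hb.2] at hτb
        exact mem_uIcc.2 (Or.inl ⟨hb.1, hτb.1⟩)
      · rw [uIcc_of_ge h] at hb
        rw [uIcc_of_ge hb.1] at hτb
        exact mem_uIcc.2 (Or.inr ⟨hτb.2, hb.2⟩)
    obtain ⟨E₁, F₁, G₁⟩ := H₁ p hp₁ b right_mem_uIcc
    obtain ⟨E₂, F₂, G₂⟩ := H₂ p hp₂ τ hτb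
    refine ⟨fun x hx => ?_, fun x hx y hy => ?_, fun x₁ hx₁ x₂ hx₂ y₁ y₂ hy₁ hy₂ => ?_⟩
    · obtain ⟨w, hw⟩ := E₁ x hx
      obtain ⟨y, hy⟩ := E₂ w ((F₁ x hx w hw).2 rfl)
      exact ⟨y, hw.trans hy hbτ⟩
    · obtain ⟨w, hw, hwy⟩ := hy.exists_between hbτ
      have := F₂ w ((F₁ x hx w hw).2 rfl) y hwy
      exact ⟨Or.inr this.1, this.2⟩
    · obtain ⟨w₁, hw₁, hwy₁⟩ := hy₁.exists_between hbτ
      obtain ⟨w₂, hw₂, hwy₂⟩ := hy₂.exists_between hbτ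
      rw [hC]
      refine (G₂ w₁ ((F₁ _ hx₁ _ hw₁).2 rfl) w₂ ((F₁ _ hx₂ _ hw₂).2 rfl) y₁ y₂ hwy₁ hwy₂).trans ?_
      refine le_add_left ?_
      gcongr
      exact G₁ x₁ hx₁ x₂ hx₂ w₁ w₂ hw₁ hw₂
  · have hτa : τ ∈ uIcc a b := (uIcc_subset_uIcc_union_uIcc hτ).resolve_right hτb
    have hτc : τ ≠ c := by
      rintro rfl
      exact hτb right_mem_uIcc
    obtain ⟨E₁, F₁, G₁⟩ := H₁ p hp₁ τ hτa
    refine ⟨E₁, fun x hx y hy => ⟨Or.inl (F₁ x hx y hy).1, fun h => absurd h hτc⟩,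
      fun x₁ hx₁ x₂ hx₂ y₁ y₂ hy₁ hy₂ => ?_⟩
    rw [hC]
    exact le_add_right (G₁ x₁ hx₁ x₂ hx₂ y₁ y₂ hy₁ hy₂)

variable [FiniteDimensional ℝ E] [T2Space M]
  [IsContinuousRiemannianBundle E (fun x : M => TangentSpace 𝓘(ℝ, E) x)]
  {nabla : CovariantDerivative 𝓘(ℝ, E) E (fun x : M => TangentSpace 𝓘(ℝ, E) x)}

/-- Radii of chart balls on which the estimates used for the local flow hold. -/
theorem exists_chart_radius (hsm : nabla.ContMDiffCovariantDerivative ∞) (z : M) :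
    ∃ (C : ℝ) (D : ℝ≥0) (r R : ℝ), 0 ≤ C ∧ 0 < r ∧ r < R ∧
      Metric.closedBall (extChartAt 𝓘(ℝ, E) z z) R ⊆ (extChartAt 𝓘(ℝ, E) z).target ∧
      (∀ ξ : (x : M) → TangentSpace 𝓘(ℝ, E) x, IsLipSection ξ →
        pLip nabla ((extChartAt 𝓘(ℝ, E) z).symm ''
          Metric.closedBall (extChartAt 𝓘(ℝ, E) z z) r) ξ ≠ ⊤ →
        (∀ u ∈ Metric.closedBall (extChartAt 𝓘(ℝ, E) z z) r,
          ‖chartRep z ξ u‖ ≤ C * (pLip nabla ((extChartAt 𝓘(ℝ, E) z).symm ''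
            Metric.closedBall (extChartAt 𝓘(ℝ, E) z z) r) ξ).toReal) ∧
        ∀ u ∈ Metric.closedBall (extChartAt 𝓘(ℝ, E) z z) r,
          ∀ v ∈ Metric.closedBall (extChartAt 𝓘(ℝ, E) z z) r,
          ‖chartRep z ξ u - chartRep z ξ v‖ ≤ C * (pLip nabla ((extChartAt 𝓘(ℝ, E) z).symm ''
            Metric.closedBall (extChartAt 𝓘(ℝ, E) z z) r) ξ).toReal * ‖u - v‖) ∧
      ∀ u ∈ Metric.closedBall (extChartAt 𝓘(ℝ, E) z z) r,
        ∀ v ∈ Metric.closedBall (extChartAt 𝓘(ℝ, E) z z) r,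
        Manifold.riemannianEDist 𝓘(ℝ, E) ((extChartAt 𝓘(ℝ, E) z).symm u)
            ((extChartAt 𝓘(ℝ, E) z).symm v) ≤ D * edist u v ∧
        edist u v ≤ D * Manifold.riemannianEDist 𝓘(ℝ, E) ((extChartAt 𝓘(ℝ, E) z).symm u)
            ((extChartAt 𝓘(ℝ, E) z).symm v) := by
  set φ := extChartAt 𝓘(ℝ, E) z with hφ
  obtain ⟨C, hC, hCr⟩ := exists_chartRep_lipschitz nabla hsm z
  obtain ⟨D₁, V₁, hV₁, hD₁⟩ := exists_riemannianEDist_le (E := E) z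
  obtain ⟨D₂, V₂, hV₂, hD₂⟩ := exists_edist_extChartAt_le (E := E) z
  have hcs : Tendsto φ.symm (𝓝 (φ z)) (𝓝 z) := by
    have := (continuousAt_extChartAt_symm (I := 𝓘(ℝ, E)) z).tendsto
    rwa [extChartAt_to_inv] at this
  obtain ⟨R, hR, hball⟩ := Metric.nhds_basis_closedBall.mem_iff.1
    (inter_mem ((isOpen_extChartAt_target (I := 𝓘(ℝ, E)) z).mem_nhds (mem_extChartAt_target z))
      (hcs (inter_mem hV₁ hV₂)))
  obtain ⟨r, hr, hr0, hrR⟩ := (hCr.and (Ioo_mem_nhdsGT hR)).exists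
  have hsub : Metric.closedBall (φ z) r ⊆ Metric.closedBall (φ z) R :=
    Metric.closedBall_subset_closedBall hrR.le
  refine ⟨C, D₁ + D₂, r, R, hC, hr0, hrR, fun u hu => (hball hu).1,
    fun ξ hξ hfin => hr ξ hξ _ rfl hfin, fun u hu v hv => ⟨?_, ?_⟩⟩
  · have h1 := hD₁ _ (hball (hsub hu)).2.1 _ (hball (hsub hv)).2.1
    rw [← hφ, φ.right_inv (hball (hsub hu)).1, φ.right_inv (hball (hsub hv)).1] at h1
    refine h1.trans ?_
    gcongr
    simp
  · have h1 := hD₂ _ (hball (hsub hu)).2.2 _ (hball (hsub hv)).2.2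
    rw [← hφ, φ.right_inv (hball (hsub hu)).1, φ.right_inv (hball (hsub hv)).1] at h1
    refine h1.trans ?_
    gcongr
    simp

/-- Around each point and each time, the flow is Lipschitz over short time intervals. -/
theorem IsLipPLI.exists_hasLipschitzFlow (hX : IsLipPLI nabla T X)
    (hsm : nabla.ContMDiffCovariantDerivative ∞) (p₀ : P) {S : Set ℝ} (hS : IsCompact S)
    (hST : S ⊆ T) (z : M) :
    ∃ δ > 0, ∃ N ∈ 𝓝 z, ∀ a b : ℝ, uIcc a b ⊆ S → |b - a| < δ → ∀ x₀ ∈ N, ∀ y₀,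
      Reaches T (X p₀) b a x₀ y₀ → HasLipschitzFlow T X p₀ a b x₀ y₀ := by
  obtain ⟨C, D, r, R, hC, hr, hrR, hR, hest, hdist⟩ := exists_chart_radius (nabla := nabla) hsm z
  set φ := extChartAt 𝓘(ℝ, E) z with hφ
  set B := Metric.closedBall (φ z) r with hB
  set K := φ.symm '' B with hK
  have hsrc : ∀ {y : M}, y ∈ (chartAt E z).source ↔ y ∈ φ.source := by simp [hφ]
  have hrt : B ⊆ φ.target := (Metric.closedBall_subset_closedBall hrR.le).trans hR
  have hKc : IsCompact K := (isCompact_closedBall _ _).image_of_continuousOn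
    ((continuousOn_extChartAt_symm z).mono hrt)
  obtain ⟨hae, hfin⟩ := (hX.isLipLI p₀).integrable K hKc S hST hS
  -- The bound for `X p₀` may use only half of the allowed `1 / 2` and `r / 4`; the other half is
  -- kept for the perturbation `X p - X p₀`. The `+ 1` covers `C = 0`.
  let ε : ℝ := min (1 / 4) (r / 8) / (C + 1)
  have hε : 0 < ε := by positivity
  have hCε : C * ε ≤ min (1 / 4) (r / 8) := by
    have h0 : 0 ≤ min (1 / 4) (r / 8) := by positivity
    have h1 : (C + 1) * ε = min (1 / 4) (r / 8) := mul_div_cancel₀ _ (by positivity)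
    nlinarith
  -- Absolute continuity of the integral makes the admissible time step uniform over all
  -- subintervals of `S`.
  obtain ⟨δ, hδ, hδε⟩ := exists_pos_setLIntegral_lt_of_measure_lt hfin.ne
    (ENNReal.ofReal_pos.2 hε).ne'
  obtain ⟨δ', hδ', hδδ'⟩ : ∃ δ' : ℝ, 0 < δ' ∧ ENNReal.ofReal δ' ≤ δ := by
    rcases eq_or_ne δ ⊤ with rfl | h
    · exact ⟨1, one_pos, le_top⟩
    · exact ⟨δ.toReal, ENNReal.toReal_pos hδ.ne' h, ENNReal.ofReal_toReal_le⟩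
  have hNo : IsOpen ((chartAt E z).source ∩ φ ⁻¹' Metric.ball (φ z) (r / 2)) :=
    isOpen_extChartAt_preimage z Metric.isOpen_ball
  refine ⟨δ', hδ', _, hNo.mem_nhds ⟨mem_chart_source E z, Metric.mem_ball_self (by positivity)⟩,
    fun a b hab hlt x₀ hx₀ y₀ hy₀ W hW => ?_⟩
  have hcar₀ := isCaratheodoryOn_chartRep (X := X p₀) (I := uIcc a b) hC hest measurableSet_uIcc
    (fun t ht => (hX.isLipLI p₀).lip t (hST (hab ht)))
    ((hX.isLipLI p₀).aestronglyMeasurable_chartRep (hab.trans hST) z)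
    (hae.mono_measure (Measure.restrict_mono_set _ hab))
    ((lintegral_mono_set hab).trans_lt hfin).ne
  have hm₀ : ∫ t in uIcc a b, C * (pLip nabla K (X p₀ t)).toReal ≤ min (1 / 4) (r / 8) := by
    rw [hcar₀.2]
    refine (mul_le_mul_of_nonneg_left ?_ hC).trans hCε
    refine ENNReal.toReal_le_of_le_ofReal hε.le ?_
    have h1 := hδε (uIcc a b) (by
      refine (Measure.restrict_apply_le _ _).trans_lt (lt_of_lt_of_le ?_ hδδ')
      rw [uIcc, Real.volume_Icc, max_sub_min_eq_abs]
      exact (ENNReal.ofReal_lt_ofReal_iff hδ').2 hlt)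
    rw [Measure.restrict_restrict_of_subset hab] at h1
    exact h1.le
  have hmin1 := min_le_left (1 / 4 : ℝ) (r / 8)
  have hmin2 := min_le_right (1 / 4 : ℝ) (r / 8)
  have hball : ∀ {x}, φ x ∈ Metric.ball (φ z) (r / 2) → φ x ∈ Metric.closedBall (φ z) (r / 2) :=
    fun h => Metric.ball_subset_closedBall h
  obtain ⟨v, hvc, hvB, hva, hv, hvr⟩ := exists_solution_reaches_iff (hab.trans hST) hr hrR hR
    hcar₀.1 (by linarith) (by linarith) hx₀.1 (hball hx₀.2)
  have hy₀v : y₀ = φ.symm (v b) := (hvr b right_mem_uIcc y₀).1 hy₀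
  obtain ⟨η, hη, hηW⟩ : ∃ η > 0, ∀ e, dist e (v b) < η → φ.symm e ∈ W := by
    have h1 := ((continuousOn_extChartAt_symm z).continuousAt
      ((isOpen_extChartAt_target z).mem_nhds (hrt (hvB b right_mem_uIcc)))).preimage_mem_nhds
      (hy₀v ▸ hW)
    exact Metric.mem_nhds_iff.1 h1
  -- The second entry makes the endpoint land in `W`: stability gives a deviation of at most `2 * (η
  -- / 8 + η / 8) < η`, one `η / 8` coming from the initial value and one from the parameter.
  let ε₂ : ℝ := min ε (η / (8 * (C + 1)))
  have hε₂ : 0 < ε₂ := by positivity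
  have hCε₂ : C * ε₂ ≤ min (1 / 4) (r / 8) :=
    (mul_le_mul_of_nonneg_left (min_le_left _ _) hC).trans hCε
  have hCε₂' : C * ε₂ ≤ η / 8 := by
    have h1 : (C + 1) * (η / (8 * (C + 1))) = η / 8 := by field_simp
    have h2 : 0 < η / (8 * (C + 1)) := by positivity
    nlinarith [mul_le_mul_of_nonneg_left (min_le_right ε (η / (8 * (C + 1)))) hC]
  have hU : ((chartAt E z).source ∩ φ ⁻¹' Metric.ball (φ z) (r / 2)) ∩
      ((chartAt E z).source ∩ φ ⁻¹' Metric.ball (φ x₀) (η / 8)) ∈ 𝓝 x₀ :=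
    inter_mem (hNo.mem_nhds hx₀) ((isOpen_extChartAt_preimage z Metric.isOpen_ball).mem_nhds
      ⟨hx₀.1, Metric.mem_ball_self (by positivity)⟩)
  -- The constant is a passage to the chart, the factor `2` of the stability estimate, and the
  -- passage back. It depends only on `z`, not on `p`.
  refine ⟨D * 2 * D, _, hU, _, hX.continuous p₀ K hKc S hST hS (ENNReal.ofReal ε₂)
    (ENNReal.ofReal_pos.2 hε₂), K, hKc, fun p hp τ hτ => ?_⟩
  obtain ⟨hpae, hpfin⟩ := hp
  -- Splitting off the difference yields a Lipschitz bound for `X p` directly from the continuity in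
  -- the parameter, whose seminorm is that of `X p - X p₀`.
  have hrep : ∀ t u, chartRep z (X p t) u =
      chartRep z (X p₀ t) u + chartRep z (X p t - X p₀ t) u := fun t u => by
    simp only [chartRep, localRep_sub, add_sub_cancel]
  have hplt : ∫⁻ t in uIcc a b, pLip nabla K (X p t - X p₀ t) < ENNReal.ofReal ε₂ :=
    (lintegral_mono_set hab).trans_lt hpfin
  have hcar₁ := isCaratheodoryOn_chartRep (X := fun t => X p t - X p₀ t) (I := uIcc a b) hC hest
    measurableSet_uIcc
    (fun t ht => ((hX.isLipLI p).lip t (hST (hab ht))).sub ((hX.isLipLI p₀).lip t (hST (hab ht))))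
    (fun u => by
      have h1 := ((hX.isLipLI p).aestronglyMeasurable_chartRep (hab.trans hST) z u).sub
        ((hX.isLipLI p₀).aestronglyMeasurable_chartRep (hab.trans hST) z u)
      refine h1.congr (ae_of_all _ fun t => ?_)
      simp [chartRep, localRep_sub])
    (hpae.mono_measure (Measure.restrict_mono_set _ hab)) hplt.ne_top
  have hn : ∫ t in uIcc a b, C * (pLip nabla K (X p t - X p₀ t)).toReal ≤ C * ε₂ := by
    rw [hcar₁.2]
    exact mul_le_mul_of_nonneg_left (ENNReal.toReal_le_of_le_ofReal hε₂.le hplt.le) hC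
  have hcar : IsCaratheodoryOn (fun t => chartRep z (X p t))
      (fun t => C * (pLip nabla K (X p₀ t)).toReal + C * (pLip nabla K (X p t - X p₀ t)).toReal)
      B (uIcc a b) := by
    have h1 := hcar₀.1.add hcar₁.1
    simp only [← hrep] at h1
    exact h1
  have hm : ∫ t in uIcc a b, (C * (pLip nabla K (X p₀ t)).toReal +
      C * (pLip nabla K (X p t - X p₀ t)).toReal) ≤ 2 * min (1 / 4) (r / 8) := by
    rw [integral_add hcar₀.1.integrable hcar₁.1.integrable]
    linarith
  have hsol := fun x (hx : x ∈ (chartAt E z).source ∩ φ ⁻¹' Metric.ball (φ z) (r / 2)) =>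
    exists_solution_reaches_iff (hab.trans hST) hr hrR hR hcar (by linarith) (by linarith) hx.1
      (hball hx.2)
  refine ⟨fun x hx => ?_, fun x hx y hy => ?_, fun x₁ hx₁ x₂ hx₂ y₁ y₂ hy₁ hy₂ => ?_⟩
  · obtain ⟨u, -, -, -, -, hur⟩ := hsol x hx.1
    exact ⟨_, (hur τ hτ _).2 rfl⟩
  · obtain ⟨u, huc, huB, hua, hu, hur⟩ := hsol x hx.1
    rw [hur τ hτ y] at hy
    refine ⟨hy ▸ mem_image_of_mem _ (huB τ hτ), ?_⟩
    rintro rfl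
    rw [hy]
    refine hηW _ ?_
    have h1 := norm_sub_le_of_integral_eq hcar hcar₀.1 (by linarith) hcar₁.1.integrable
      (hcar₁.1.bound.mono fun t ht e he => by
        rw [hrep, add_sub_cancel_left]
        exact ht.2.1 e he) huc hvc huB hvB hu hv τ hτ
    have h2 : ‖u a - v a‖ < η / 8 := by
      rw [hua, hva, ← dist_eq_norm]
      exact hx.2.2
    rw [dist_eq_norm]
    linarith
  · obtain ⟨u₁, hu₁c, hu₁B, hu₁a, hu₁, hu₁r⟩ := hsol x₁ hx₁.1
    obtain ⟨u₂, hu₂c, hu₂B, hu₂a, hu₂, hu₂r⟩ := hsol x₂ hx₂.1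
    rw [hu₁r τ hτ] at hy₁
    rw [hu₂r τ hτ] at hy₂
    have h1 := norm_sub_le_of_integral_eq (n := 0) hcar hcar (by linarith) integrableOn_zero
      (ae_of_all _ fun t e _ => by simp) hu₁c hu₂c hu₁B hu₂B hu₁ hu₂ τ hτ
    have h2 : edist (u₁ τ) (u₂ τ) ≤ 2 * edist (u₁ a) (u₂ a) := by
      rw [edist_dist, edist_dist, ← ENNReal.ofReal_ofNat, ← ENNReal.ofReal_mul zero_le_two]
      refine ENNReal.ofReal_le_ofReal ?_
      simpa [dist_eq_norm] using h1
    have h3 := (hdist _ (hu₁B a left_mem_uIcc) _ (hu₂B a left_mem_uIcc)).2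
    rw [hu₁a, hu₂a, φ.left_inv (hsrc.1 hx₁.1.1), φ.left_inv (hsrc.1 hx₂.1.1), ← hu₁a, ← hu₂a] at h3
    rw [hy₁, hy₂]
    calc _ ≤ D * edist (u₁ τ) (u₂ τ) := (hdist _ (hu₁B τ hτ) _ (hu₂B τ hτ)).1
      _ ≤ D * (2 * (D * Manifold.riemannianEDist 𝓘(ℝ, E) x₁ x₂)) := by
        gcongr
        exact h2.trans (by gcongr)
      _ = _ := by push_cast; ring

end FlowStep

/-! ### The flow along an integral curve -/

section Global

variable {E : Type*} [NormedAddCommGroup E] [NormedSpace ℝ E] [FiniteDimensional ℝ E]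
  {M : Type*} [TopologicalSpace M] [ChartedSpace E M] [IsManifold 𝓘(ℝ, E) ∞ M] [T2Space M]
  [RiemannianBundle (fun x : M => TangentSpace 𝓘(ℝ, E) x)]
  [IsContinuousRiemannianBundle E (fun x : M => TangentSpace 𝓘(ℝ, E) x)]
  {nabla : CovariantDerivative 𝓘(ℝ, E) E (fun x : M => TangentSpace 𝓘(ℝ, E) x)}
  {P : Type*} [TopologicalSpace P]
  {T : Set ℝ} {X : P → ℝ → (x : M) → TangentSpace 𝓘(ℝ, E) x} {p₀ : P}

theorem add_mul_sub_mem_uIcc {a b s t : ℝ} (hs : 0 ≤ s) (hst : s ≤ t) :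
    a + s * (b - a) ∈ uIcc a (a + t * (b - a)) := by
  rcases le_total a b with h | h
  · exact mem_uIcc.2 (Or.inl ⟨by nlinarith, by nlinarith⟩)
  · exact mem_uIcc.2 (Or.inr ⟨by nlinarith, by nlinarith⟩)

/-- The flow is Lipschitz along every integral curve. -/
theorem IsIntCurve.hasLipschitzFlow (hX : IsLipPLI nabla T X)
    (hsm : nabla.ContMDiffCovariantDerivative ∞) {γ : ℝ → M} {t₀ t₁ : ℝ}
    (hγ : IsIntCurve T (X p₀) γ (uIcc t₀ t₁)) :
    HasLipschitzFlow T X p₀ t₀ t₁ (γ t₀) (γ t₁) := by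
  -- The affine parametrisation treats both orders of `t₀` and `t₁` at once.
  let G : unitInterval → ℝ := fun s => t₀ + s * (t₁ - t₀)
  have hGc : Continuous G := by fun_prop
  have hG0 : G 0 = t₀ := by simp [G]
  have hG1 : G 1 = t₁ := by simp [G]
  have hGS : ∀ s, G s ∈ uIcc t₀ t₁ := fun s => by
    have := add_mul_sub_mem_uIcc (a := t₀) (b := t₁) s.2.1 s.2.2
    rwa [one_mul, add_sub_cancel] at this
  have hγG : Continuous (γ ∘ G) :=
    (hγ.locAC.continuousOn left_mem_uIcc right_mem_uIcc).comp_continuous hGc hGS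
  choose δ hδ N hN hstep using fun s =>
    hX.exists_hasLipschitzFlow hsm p₀ isCompact_uIcc hγ.subset (γ (G s))
  -- The radius `δ s / 2` ensures that two times in the same `c s` differ by less than `δ s`, the
  -- step allowed by the local result.
  let c : unitInterval → Set unitInterval := fun s =>
    interior ((γ ∘ G) ⁻¹' N s ∩ G ⁻¹' Metric.ball (G s) (δ s / 2))
  obtain ⟨t, ht0, htm, ⟨n, hn⟩, htc⟩ := exists_monotone_Icc_subset_open_cover_unitInterval
    (c := c) (fun _ => isOpen_interior) fun s _ => mem_iUnion.2 ⟨s, mem_interior_iff_mem_nhds.2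
      (inter_mem (hγG.continuousAt.preimage_mem_nhds (hN s))
        (hGc.continuousAt.preimage_mem_nhds (Metric.ball_mem_nhds _ (half_pos (hδ s)))))⟩
  have hloc : ∀ s u v, u ∈ c s → v ∈ c s →
      HasLipschitzFlow T X p₀ (G u) (G v) (γ (G u)) (γ (G v)) := by
    intro s u v hu hv
    have hu := interior_subset hu
    have hv := interior_subset hv
    refine hstep s _ _ (uIcc_subset_uIcc (hGS u) (hGS v)) ?_ _ hu.1 _
      ⟨_, γ, hγ, hGS u, rfl, hGS v, rfl⟩
    have h1 : dist (G u) (G s) < δ s / 2 := hu.2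
    have h2 : dist (G v) (G s) < δ s / 2 := hv.2
    rw [← Real.dist_eq]
    linarith [dist_triangle_right (G v) (G u) (G s)]
  have hmem : ∀ k, ∃ s, t k ∈ c s ∧ t (k + 1) ∈ c s := fun k => by
    obtain ⟨s, hs⟩ := htc k
    exact ⟨s, hs ⟨le_rfl, htm (Nat.le_succ k)⟩, hs ⟨htm (Nat.le_succ k), le_rfl⟩⟩
  have hind : ∀ k, HasLipschitzFlow T X p₀ t₀ (G (t k)) (γ t₀) (γ (G (t k))) := by
    intro k
    induction k with
    | zero =>
      obtain ⟨s, hs, -⟩ := hmem 0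
      have := hloc s _ _ hs hs
      rwa [ht0, hG0] at this ⊢
    | succ k ih =>
      obtain ⟨s, hs, hs'⟩ := hmem k
      exact ih.trans (hloc s _ _ hs hs')
        (add_mul_sub_mem_uIcc (t k).2.1 (htm (Nat.le_succ k)))
  have := hind n
  rwa [hn n le_rfl, hG1] at this

theorem reaches_flow {t t₀ : ℝ} {x : M} {p : P} (h : ∃ y, Reaches T (X p) t t₀ x y) :
    Reaches T (X p) t t₀ x (flow T X t t₀ x p) := by
  unfold flow
  rw [dif_pos h]
  exact h.choose_spec

end Global

end LipFlow

end

/-! ### From neighbourhoods of single points to the compact set `K` -/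

theorem corollary3p12
    {E : Type*} [NormedAddCommGroup E] [NormedSpace ℝ E] [FiniteDimensional ℝ E]
    {M : Type*} [TopologicalSpace M] [ChartedSpace E M] [IsManifold 𝓘(ℝ, E) ∞ M]
    [T2Space M] [SecondCountableTopology M] [ConnectedSpace M]
    [RiemannianBundle (fun x : M => TangentSpace 𝓘(ℝ, E) x)]
    [IsContMDiffRiemannianBundle 𝓘(ℝ, E) ∞ E (fun x : M => TangentSpace 𝓘(ℝ, E) x)]
    (nabla : CovariantDerivative 𝓘(ℝ, E) E (fun x : M => TangentSpace 𝓘(ℝ, E) x))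
    (hnabla : LipFlow.IsLeviCivita nabla)
    {P : Type*} [TopologicalSpace P]
    (T : Set ℝ) (hT : T.OrdConnected)
    (X : P → ℝ → (x : M) → TangentSpace 𝓘(ℝ, E) x)
    (hX : LipFlow.IsLipPLI nabla T X)
    (K : Set M) (hK : IsCompact K)
    (t₀ t₁ : ℝ) (ht₀ : t₀ ∈ T) (ht₁ : t₁ ∈ T) (p₀ : P)
    (hdom : ∀ t ∈ uIcc t₀ t₁, ∀ x ∈ K, (t, t₀, x, p₀) ∈ LipFlow.flowDomain T X) :
    ∃ O ∈ 𝓝 p₀, ∃ C : ℝ, 0 < C ∧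
      (∀ t ∈ uIcc t₀ t₁, ∀ x ∈ K, ∀ p ∈ O, (t, t₀, x, p) ∈ LipFlow.flowDomain T X) ∧
      ∀ t ∈ uIcc t₀ t₁, ∀ x₁ ∈ K, ∀ x₂ ∈ K, ∀ p ∈ O,
        Manifold.riemannianEDist 𝓘(ℝ, E)
            (LipFlow.flow T X t t₀ x₁ p) (LipFlow.flow T X t t₀ x₂ p)
          ≤ ENNReal.ofReal C * Manifold.riemannianEDist 𝓘(ℝ, E) x₁ x₂ := by
  have := LipFlow.regularSpace_of_finiteDimensional E M
  have : IsContinuousRiemannianBundle E (fun x : M => TangentSpace 𝓘(ℝ, E) x) := by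
    obtain ⟨g, hg, hg'⟩ := IsContMDiffRiemannianBundle.exists_contMDiff (IB := 𝓘(ℝ, E)) (n := ∞)
      (F := E) (E := fun x : M => TangentSpace 𝓘(ℝ, E) x)
    exact ⟨g, hg.continuous, hg'⟩
  have hx : ∀ x : K, ∃ C : ℝ≥0, ∃ U ∈ 𝓝 (x : M), ∃ O ∈ 𝓝 p₀, ∃ L : Set M, IsCompact L ∧
      ∀ p ∈ O, ∀ τ ∈ uIcc t₀ t₁, (∀ x ∈ U, ∃ y, LipFlow.Reaches T (X p) τ t₀ x y) ∧
      (∀ x ∈ U, ∀ y, LipFlow.Reaches T (X p) τ t₀ x y → y ∈ L ∧ (τ = t₁ → y ∈ univ)) ∧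
      ∀ x₁ ∈ U, ∀ x₂ ∈ U, ∀ y₁ y₂, LipFlow.Reaches T (X p) τ t₀ x₁ y₁ →
        LipFlow.Reaches T (X p) τ t₀ x₂ y₂ →
        Manifold.riemannianEDist 𝓘(ℝ, E) y₁ y₂
          ≤ C * Manifold.riemannianEDist 𝓘(ℝ, E) x₁ x₂ := by
    rintro ⟨x, hx⟩
    obtain ⟨y, hy⟩ : ∃ y, LipFlow.Reaches T (X p₀) t₁ t₀ x y := (hdom t₁ right_mem_uIcc x hx).2.2
    obtain ⟨γ, hγ, rfl, rfl⟩ := LipFlow.Reaches.exists_isIntCurve_uIcc hy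
    exact LipFlow.IsIntCurve.hasLipschitzFlow hX hnabla.smooth hγ univ univ_mem
  choose C U hU O hO L hL H using hx
  -- Doubling the radius acts as a Lebesgue number: a point within `ρ` of a point that is within `ρ`
  -- of `x` still lies in `U x`.
  have hρ : ∀ x : K, ∃ ρ : ℝ≥0, 0 < ρ ∧
      {y | Manifold.riemannianEDist 𝓘(ℝ, E) (x : M) y < ρ + ρ} ⊆ U x := by
    intro x
    obtain ⟨c, hc, hcU⟩ := setOfPred_riemannianEDist_lt_subset_nhds' 𝓘(ℝ, E) (hU x)
    obtain ⟨ρ, hρ, hρc⟩ := ENNReal.lt_iff_exists_nnreal_btwn.1 (ENNReal.half_pos hc.ne')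
    refine ⟨ρ, by exact_mod_cast hρ, fun y hy => hcU (mem_ofPred.2 (lt_of_lt_of_le hy ?_))⟩
    rw [← ENNReal.add_halves c]
    exact add_le_add hρc.le hρc.le
  choose ρ hρ0 hρ using hρ
  obtain ⟨s, hs⟩ := hK.elim_nhds_subcover'
    (fun x hx => {y | Manifold.riemannianEDist 𝓘(ℝ, E) x y < ρ ⟨x, hx⟩})
    fun x hx => eventually_riemannianEDist_lt 𝓘(ℝ, E) x (by exact_mod_cast hρ0 ⟨x, hx⟩)
  have hcov : ∀ x ∈ K, ∃ i ∈ s, Manifold.riemannianEDist 𝓘(ℝ, E) (i : M) x < ρ i := by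
    intro x hx
    simpa using hs hx
  have hsubU : ∀ (i : K) x, Manifold.riemannianEDist 𝓘(ℝ, E) (i : M) x < ρ i → x ∈ U i :=
    fun i x h => hρ i (h.trans_le le_self_add)
  obtain ⟨D, hD⟩ := LipFlow.exists_riemannianEDist_le_of_isCompact (E := E)
    (s.isCompact_biUnion fun i _ => hL i)
  -- The first sum dominates each local Lipschitz constant, for close initial points; the second
  -- term dominates each `D / ρ i`, for distant ones.
  let A : ℝ≥0 := ∑ i ∈ s, C i + D * ∑ i ∈ s, (ρ i)⁻¹
  have hreach : ∀ t ∈ uIcc t₀ t₁, ∀ x ∈ K, ∀ p ∈ ⋂ i ∈ s, O i,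
      ∃ i ∈ s, Manifold.riemannianEDist 𝓘(ℝ, E) (i : M) x < ρ i ∧
      LipFlow.Reaches T (X p) t t₀ x (LipFlow.flow T X t t₀ x p) ∧
      LipFlow.flow T X t t₀ x p ∈ L i := by
    intro t ht x hx p hp
    obtain ⟨i, hi, hix⟩ := hcov x hx
    have h1 := H i p (mem_iInter₂.1 hp i hi) t ht
    have h2 := LipFlow.reaches_flow (h1.1 x (hsubU i x hix))
    exact ⟨i, hi, hix, h2, (h1.2.1 x (hsubU i x hix) _ h2).1⟩
  refine ⟨⋂ i ∈ s, O i, (biInter_finset_mem s).2 fun i _ => hO i, A + 1, by positivity,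
    fun t ht x hx p hp => ?_, fun t ht x₁ hx₁ x₂ hx₂ p hp => ?_⟩
  · obtain ⟨i, -, -, h, -⟩ := hreach t ht x hx p hp
    exact ⟨hT.uIcc_subset ht₀ ht₁ ht, ht₀, _, h⟩
  obtain ⟨i, hi, hix, h₁, hL₁⟩ := hreach t ht x₁ hx₁ p hp
  obtain ⟨j, hj, -, h₂, hL₂⟩ := hreach t ht x₂ hx₂ p hp
  have hA : (A : ℝ≥0∞) ≤ ENNReal.ofReal (A + 1) := by
    rw [← ENNReal.ofReal_coe_nnreal]
    exact ENNReal.ofReal_le_ofReal (by simp)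
  refine le_trans ?_ (mul_le_mul_left hA _)
  -- The index `i` is chosen from `x₁` alone. If `x₂` is within `ρ i` of `x₁`, both lie in `U i`;
  -- otherwise the diameter bound `D` is paid for by `d(x₁, x₂) ≥ ρ i`.
  by_cases hlt : Manifold.riemannianEDist 𝓘(ℝ, E) x₁ x₂ < ρ i
  · have hx₂U : x₂ ∈ U i := hρ i
      ((Manifold.riemannianEDist_triangle (y := x₁)).trans_lt (ENNReal.add_lt_add hix hlt))
    refine ((H i p (mem_iInter₂.1 hp i hi) t ht).2.2 x₁ (hsubU i x₁ hix) x₂ hx₂U _ _ h₁ h₂).trans ?_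
    gcongr
    exact (Finset.single_le_sum (f := C) (fun _ _ => zero_le) hi).trans le_self_add
  · have h3 := hD _ (mem_biUnion hi hL₁) _ (mem_biUnion hj hL₂)
    have h4 : (ρ i)⁻¹ ≤ ∑ i ∈ s, (ρ i)⁻¹ :=
      Finset.single_le_sum (f := fun i => (ρ i)⁻¹) (fun _ _ => zero_le) hi
    calc _ ≤ (D : ℝ≥0∞) := h3
      _ = ((D * (ρ i)⁻¹ : ℝ≥0) : ℝ≥0∞) * ρ i := by
        rw [← ENNReal.coe_mul, mul_assoc, inv_mul_cancel₀ (hρ0 i).ne', mul_one]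
      _ ≤ A * Manifold.riemannianEDist 𝓘(ℝ, E) x₁ x₂ := by
        gcongr
        · exact (mul_le_mul_right h4 _).trans le_add_self
        · exact not_lt.1 hlt
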